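/- Let $T>0$ and $1<q<p<\infty$. For $r>1$ let $W_0^{1,r}=W_0^{1,r}(0,T)$ be the closure of $C_c^\infty(0,T)$ in $W^{1,r}(0,T)$, normed by $\|u'\|_r$, where $\|f\|_r^r=\int_0^T|f|^r\,dx$. Put $$\lambda_1(r)=\inf\left\{\frac{\|u'\|_r^r}{\|u\|_r^r}:\ u\in W_0^{1,r},\ u\not\equiv0\right\},\qquad \lambda_2(r)=\inf_{h}\ \max_{z\in S^1}\|h(z)'\|_r^r,$$ where $S^1$ is the unit circle in $\mathbb{R}^2$ and $h$ runs over all odd continuous maps from $S^1$ to $\{u\in W_0^{1,r}:\|u\|_r=1\}$ (these are the first two eigenvalues of the Dirichlet $r$-Laplacian on $(0,T)$). A first eigenfunction of the Dirichlet $p$-Laplacian on $(0,T)$ is a function $\varphi_p\in W_0^{1,p}$, $\varphi_p\not\equiv0$, such that $$\int_0^T|\varphi_p'|^{p-2}\varphi_p'\,v'\,dx=\lambda_1(p)\int_0^T|\varphi_p|^{p-2}\varphi_p\,v\,dx\qquad\text{for all } v\in W_0^{1,p}.$$ Then a first eigenfunction exists, and every first eigenfunction $\varphi_p$ satisfies $$\lambda_1(q)<\frac{\|\varphi_p'\|_q^q}{\|\varphi_p\|_q^q}<\lambda_2(q).$$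 -/

import Mathlib

open MeasureTheory Filter Topology Set
open scoped ContDiff

namespace PLaplace1D

/-- The measure space underlying all function spaces: Lebesgue measure on `(0, T)`. -/
noncomputable def intervalMeasure (T : ℝ) : Measure ℝ :=
  (volume : Measure ℝ).restrict (Ioo 0 T)

/-- The `r`-th power `‖f‖_r ^ r` of the norm of `L^r(0, T)`. -/
noncomputable def normPow (T r : ℝ) (f : ℝ → ℝ) : ℝ :=
  ∫ x, |f x| ^ r ∂(intervalMeasure T)

/-- Smooth functions with compact support contained in `(0, T)`. -/
def IsTestFunction (T : ℝ) (φ : ℝ → ℝ) : Prop :=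
  ContDiff ℝ ∞ φ ∧ HasCompactSupport φ ∧ tsupport φ ⊆ Ioo 0 T

/-- `u` belongs to `W_0^{1,r}(0, T)`, the closure of the test functions in `W^{1,r}(0, T)`, and
`du` is (a representative of) its weak derivative. Functions matter only almost everywhere
on `(0, T)`. -/
def MemSobolevZero (T r : ℝ) (u du : ℝ → ℝ) : Prop :=
  MemLp u (ENNReal.ofReal r) (intervalMeasure T) ∧
  MemLp du (ENNReal.ofReal r) (intervalMeasure T) ∧
  ∃ φ : ℕ → ℝ → ℝ, (∀ n, IsTestFunction T (φ n)) ∧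
    Tendsto (fun n => eLpNorm (φ n - u) (ENNReal.ofReal r) (intervalMeasure T)) atTop (𝓝 0) ∧
    Tendsto (fun n => eLpNorm (deriv (φ n) - du) (ENNReal.ofReal r) (intervalMeasure T))
      atTop (𝓝 0)

/-- `u`, with weak derivative `du`, is an eigenfunction of the Dirichlet `r`-Laplacian on `(0, T)`
for the eigenvalue `lam`: a nontrivial weak solution of `-(|u'|^{r-2} u')' = lam |u|^{r-2} u`,
`u(0) = u(T) = 0`. -/
def IsEigenfunction (T r lam : ℝ) (u du : ℝ → ℝ) : Prop :=
  MemSobolevZero T r u du ∧ ¬ (u =ᵐ[intervalMeasure T] 0) ∧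
  ∀ v dv : ℝ → ℝ, MemSobolevZero T r v dv →
    ∫ x, |du x| ^ (r - 2) * du x * dv x ∂(intervalMeasure T)
      = lam * ∫ x, |u x| ^ (r - 2) * u x * v x ∂(intervalMeasure T)

/-- The first eigenvalue `λ₁(r)`, the infimum of the Rayleigh quotient over
`W_0^{1,r}(0, T) \ {0}`. -/
noncomputable def firstEigenvalue (T r : ℝ) : ℝ :=
  sInf {ρ : ℝ | ∃ u du : ℝ → ℝ, MemSobolevZero T r u du ∧ ¬ (u =ᵐ[intervalMeasure T] 0) ∧
    ρ = normPow T r du / normPow T r u}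

/-- `h`, with weak derivatives `dh`, is an odd continuous map from the unit sphere of `ℝ^k`
to `{u ∈ W_0^{1,r}(0, T) : ‖u‖_r = 1}`, where `W_0^{1,r}(0, T)` has the norm `‖u'‖_r`. -/
def IsOddSphereMap (T r : ℝ) (k : ℕ)
    (h dh : Metric.sphere (0 : EuclideanSpace ℝ (Fin k)) 1 → ℝ → ℝ) : Prop :=
  (∀ z, MemSobolevZero T r (h z) (dh z) ∧ normPow T r (h z) = 1) ∧
  (∀ z, h (-z) =ᵐ[intervalMeasure T] -h z) ∧
  ∀ z₀, Tendsto (fun z => eLpNorm (dh z - dh z₀) (ENNReal.ofReal r) (intervalMeasure T))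
    (𝓝 z₀) (𝓝 0)

/-- The variational eigenvalue `λ_k(r) = inf_h max_z ‖h(z)'‖_r ^ r`, `k ≥ 1`, the infimum being
over all odd continuous maps `h` from the unit sphere of `ℝ^k` to the unit `L^r`-sphere of
`W_0^{1,r}(0, T)`. -/
noncomputable def variationalEigenvalue (T r : ℝ) (k : ℕ) : ℝ :=
  sInf {M : ℝ | ∃ h dh : Metric.sphere (0 : EuclideanSpace ℝ (Fin k)) 1 → ℝ → ℝ,
    IsOddSphereMap T r k h dh ∧ IsGreatest (range fun z => normPow T r (dh z)) M}

end PLaplace1D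

/-! Everything is compared with one explicit constant. With `quarterPeriod r` the integral of `(1 -
s ^ r) ^ (-1 / r)` over (0, 1), put Λ_r(l) = `quarterEigenvalue r l` = (r - 1)(`quarterPeriod r` /
l)^r.

The core is a sharp one-sided Poincaré inequality, `quarterEigenvalue_mul_le`: Λ_r(l) ∫ |u|^r ≤ ∫
|u'|^r on (0, l) when u(0) = 0. Let S and k = S' be the generalized sine and cosine scaled to (0,
l). A weighted Hölder (tangent line) argument gives |u(x)|^r ≤ S(x)^(r-1) ∫_0^x |u'|^r k^(1-r).
Multiplying by Λ_r(l) S^(r-1)/S^(r-1), that is integrating against Λ_r(l), and exchanging the order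
of integration, the equation (k^(r-1))' = -Λ_r(l) S^(r-1) makes the weights cancel. Equality forces
u' to be a multiple of k. Cutting an interval at its midpoint yields the Dirichlet inequality and
its equality case. Hence λ₁(r) = Λ_r(T/2), and testing the weak equation with the eigenfunction
itself puts it in the equality case: first eigenfunctions are exactly the nonzero multiples of
`waveSin r T`. So only the quotient of `waveSin p T` has to be estimated.

Lower bound: equality would make the waves for p and q proportional, hence equal, which contradicts
(1 - s^q)^(1/q) < (1 - s^p)^(1/p).

Upper bound: with P and Q equal to `quarterPeriod p` and `quarterPeriod q` divided by T/2, concavity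
of the sine and crude bounds give a quotient at most (1 + q) Q^(q-1) (2/T). Since 1 + q < 2^q and (q
- 1) `quarterPeriod q` ≥ 1, this lies below 2^q Λ_q(T/2) = Λ_q(T/4) (`normPow_wave_div_lt`). Finally
Λ_q(T/4) ≤ λ₂(q): an odd map on the circle contains a function vanishing at T/2, to which the
Dirichlet inequality applies on each half. -/

namespace PLaplace1D

/-! ### Generalized sine and cosine. -/

/-- The integrand `(1 - s ^ r) ^ (-1 / r)` of the generalized arcsine, extended by `1`. -/
noncomputable def arcDensity (r s : ℝ) : ℝ :=
  1 + (Ioo (0 : ℝ) 1).indicator (fun s => (1 - s ^ r) ^ (-(1 / r)) - 1) s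

/-- The generalized arcsine. -/
noncomputable def arc (r y : ℝ) : ℝ := ∫ s in (0 : ℝ)..y, arcDensity r s

/-- Half of the generalized `π`. -/
noncomputable def quarterPeriod (r : ℝ) : ℝ := arc r 1

lemma arcDensity_of_mem {r s : ℝ} (hs : s ∈ Ioo (0 : ℝ) 1) :
    arcDensity r s = (1 - s ^ r) ^ (-(1 / r)) := by
  simp [arcDensity, indicator_of_mem hs]

lemma one_sub_rpow_mem {r s : ℝ} (hr : 1 < r) (hs : s ∈ Ioo (0 : ℝ) 1) :
    1 - s ^ r ∈ Ioo (0 : ℝ) 1 := by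
  have h1 : s ^ r < 1 := Real.rpow_lt_one hs.1.le hs.2 (by linarith)
  have h2 : 0 < s ^ r := Real.rpow_pos_of_pos hs.1 r
  exact ⟨by linarith, by linarith⟩

lemma one_le_arcDensity {r : ℝ} (hr : 1 < r) (s : ℝ) : 1 ≤ arcDensity r s := by
  by_cases hs : s ∈ Ioo (0 : ℝ) 1
  · rw [arcDensity_of_mem hs]
    have := one_sub_rpow_mem hr hs
    exact Real.one_le_rpow_of_pos_of_le_one_of_nonpos this.1 this.2.le (by
      have : 0 < 1 / r := by positivity
      linarith)
  · simp [arcDensity, indicator_of_notMem hs]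

lemma measurable_arcDensity (r : ℝ) : Measurable (arcDensity r) := by
  unfold arcDensity
  refine measurable_const.add (Measurable.indicator ?_ measurableSet_Ioo)
  fun_prop

/-- Since `s ^ r ≤ s` on (0, 1), the singularity at 1 is dominated by `(1 - s) ^ (-1 / r)`,
integrable because r > 1. -/
lemma intervalIntegrable_arcDensity {r : ℝ} (hr : 1 < r) (a b : ℝ) :
    IntervalIntegrable (arcDensity r) volume a b := by
  have h0 : IntegrableOn (fun x : ℝ => (1 - x) ^ (-(1 / r))) (Ioo 0 1) := by
    have h : IntervalIntegrable (fun x : ℝ => x ^ (-(1 / r))) volume 0 1 := by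
      apply intervalIntegral.intervalIntegrable_rpow'
      have : 1 / r < 1 := by rw [div_lt_one (by linarith)]; exact hr
      linarith
    have h2 := (h.comp_sub_left 1).symm
    simp only [sub_self, sub_zero] at h2
    rw [intervalIntegrable_iff_integrableOn_Ioo_of_le zero_le_one] at h2
    exact h2
  have h1 : IntegrableOn (fun s : ℝ => (1 - s ^ r) ^ (-(1 / r)) - 1) (Ioo 0 1) := by
    refine Integrable.mono' h0 (Measurable.aestronglyMeasurable (by fun_prop)) ?_
    refine (ae_restrict_iff' measurableSet_Ioo).2 (ae_of_all _ fun s hs => ?_)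
    have hm := one_sub_rpow_mem hr hs
    have h3 := one_le_arcDensity hr s
    rw [arcDensity_of_mem hs] at h3
    rw [Real.norm_eq_abs, abs_of_nonneg (by linarith)]
    have h4 : (1 - s ^ r) ^ (-(1 / r)) ≤ (1 - s) ^ (-(1 / r)) := by
      apply Real.rpow_le_rpow_of_nonpos (by linarith [hs.2])
      · have : s ^ r ≤ s ^ (1 : ℝ) := Real.rpow_le_rpow_of_exponent_ge hs.1 hs.2.le hr.le
        rw [Real.rpow_one] at this
        linarith
      · have : 0 < 1 / r := by positivity
        linarith
    linarith
  have h2 := (integrable_indicator_iff measurableSet_Ioo).2 h1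
  exact intervalIntegrable_const.add h2.intervalIntegrable

lemma sub_le_arc_sub {r : ℝ} (hr : 1 < r) {a b : ℝ} (hab : a ≤ b) :
    b - a ≤ arc r b - arc r a := by
  rw [arc, arc, intervalIntegral.integral_interval_sub_left
    (intervalIntegrable_arcDensity hr _ _) (intervalIntegrable_arcDensity hr _ _)]
  have := intervalIntegral.integral_mono hab (intervalIntegrable_const (c := (1 : ℝ)))
    (intervalIntegrable_arcDensity hr a b) (one_le_arcDensity hr)
  simpa using this

lemma strictMono_arc {r : ℝ} (hr : 1 < r) : StrictMono (arc r) := fun a b hab => by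
  have := sub_le_arc_sub hr hab.le
  linarith

lemma continuous_arc {r : ℝ} (hr : 1 < r) : Continuous (arc r) :=
  intervalIntegral.continuous_primitive (intervalIntegrable_arcDensity hr) 0

@[simp] lemma arc_zero (r : ℝ) : arc r 0 = 0 := by simp [arc]

/-- The value 1 of the density off (0, 1) serves this purpose: `arc r` becomes a homeomorphism of
the line, so its inverse is continuous everywhere and no endpoint needs separate care. -/
lemma surjective_arc {r : ℝ} (hr : 1 < r) : Function.Surjective (arc r) := by
  apply (continuous_arc hr).surjective
  · refine tendsto_atTop_mono' _ ?_ tendsto_id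
    filter_upwards [eventually_ge_atTop 0] with x hx
    have := sub_le_arc_sub hr hx
    simpa using this
  · refine tendsto_atBot_mono' _ ?_ tendsto_id
    filter_upwards [eventually_le_atBot 0] with x hx
    have := sub_le_arc_sub hr hx
    simp only [arc_zero] at this
    simp only [id]
    linarith

/-- The generalized sine, the inverse of the generalized arcsine. -/
noncomputable def gsin (r x : ℝ) : ℝ := Function.invFun (arc r) x

lemma arc_gsin {r : ℝ} (hr : 1 < r) (x : ℝ) : arc r (gsin r x) = x :=
  Function.invFun_eq (surjective_arc hr x)

lemma gsin_arc {r : ℝ} (hr : 1 < r) (y : ℝ) : gsin r (arc r y) = y :=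
  (strictMono_arc hr).injective (arc_gsin hr _)

lemma strictMono_gsin {r : ℝ} (hr : 1 < r) : StrictMono (gsin r) := fun a b hab => by
  rw [← (strictMono_arc hr).lt_iff_lt, arc_gsin hr, arc_gsin hr]
  exact hab

lemma continuous_gsin {r : ℝ} (hr : 1 < r) : Continuous (gsin r) :=
  (strictMono_gsin hr).monotone.continuous_of_surjective fun y => ⟨arc r y, gsin_arc hr y⟩

lemma gsin_zero {r : ℝ} (hr : 1 < r) : gsin r 0 = 0 := by
  simpa using gsin_arc hr 0

lemma gsin_quarterPeriod {r : ℝ} (hr : 1 < r) : gsin r (quarterPeriod r) = 1 := gsin_arc hr 1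

lemma one_le_quarterPeriod {r : ℝ} (hr : 1 < r) : 1 ≤ quarterPeriod r := by
  simpa [quarterPeriod] using sub_le_arc_sub hr zero_le_one

lemma gsin_mem_Ioo {r x : ℝ} (hr : 1 < r) (hx : x ∈ Ioo 0 (quarterPeriod r)) :
    gsin r x ∈ Ioo (0 : ℝ) 1 := by
  constructor
  · simpa [gsin_zero hr] using strictMono_gsin hr hx.1
  · simpa [gsin_quarterPeriod hr] using strictMono_gsin hr hx.2

lemma gsin_mem_Icc {r x : ℝ} (hr : 1 < r) (hx : x ∈ Icc 0 (quarterPeriod r)) :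
    gsin r x ∈ Icc (0 : ℝ) 1 := by
  constructor
  · simpa [gsin_zero hr] using (strictMono_gsin hr).monotone hx.1
  · simpa [gsin_quarterPeriod hr] using (strictMono_gsin hr).monotone hx.2

lemma hasDerivAt_arc {r y : ℝ} (hr : 1 < r) (hy : y ∈ Ioo (0 : ℝ) 1) :
    HasDerivAt (arc r) ((1 - y ^ r) ^ (-(1 / r))) y := by
  have h := intervalIntegral.integral_hasDerivAt_right (intervalIntegrable_arcDensity hr 0 y)
    (measurable_arcDensity r).stronglyMeasurable.stronglyMeasurableAtFilter
    (b := y) ?_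
  · rwa [arcDensity_of_mem hy] at h
  · have : ContinuousAt (fun s : ℝ => (1 - s ^ r) ^ (-(1 / r))) y := by
      refine ContinuousAt.rpow_const ?_ (Or.inl (one_sub_rpow_mem hr hy).1.ne')
      exact continuousAt_const.sub (continuousAt_id.rpow_const (Or.inl hy.1.ne'))
    refine this.congr ?_
    filter_upwards [isOpen_Ioo.mem_nhds hy] with s hs
    rw [arcDensity_of_mem hs]

/-- The generalized cosine, the derivative of the generalized sine. -/
noncomputable def gcos (r x : ℝ) : ℝ := (1 - gsin r x ^ r) ^ (1 / r)

lemma continuous_gcos {r : ℝ} (hr : 1 < r) : Continuous (gcos r) := by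
  have h0 : 0 < r := by linarith
  exact (continuous_const.sub ((continuous_gsin hr).rpow_const fun _ => Or.inr h0.le)).rpow_const
    fun _ => Or.inr (by positivity)

lemma hasDerivAt_gsin {r x : ℝ} (hr : 1 < r) (hx : x ∈ Ioo 0 (quarterPeriod r)) :
    HasDerivAt (gsin r) (gcos r x) x := by
  have hy := gsin_mem_Ioo hr hx
  have hm := one_sub_rpow_mem hr hy
  have h := HasDerivAt.of_local_left_inverse (continuous_gsin hr).continuousAt
    (hasDerivAt_arc hr hy) (Real.rpow_pos_of_pos hm.1 _).ne'
    (Eventually.of_forall (arc_gsin hr))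
  rwa [Real.rpow_neg hm.1.le, inv_inv] at h

lemma gcos_pos {r x : ℝ} (hr : 1 < r) (hx : x ∈ Ico 0 (quarterPeriod r)) : 0 < gcos r x := by
  apply Real.rpow_pos_of_pos
  have h1 : gsin r x < 1 := by
    simpa [gsin_quarterPeriod hr] using strictMono_gsin hr hx.2
  have h0 := (gsin_mem_Icc hr ⟨hx.1, hx.2.le⟩).1
  have := Real.rpow_lt_one h0 h1 (by linarith : 0 < r)
  linarith

lemma gcos_quarterPeriod {r : ℝ} (hr : 1 < r) : gcos r (quarterPeriod r) = 0 := by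
  have : 1 / r ≠ 0 := by positivity
  simp only [gcos, gsin_quarterPeriod hr, Real.one_rpow, sub_self]
  exact Real.zero_rpow this

lemma gcos_le_one {r x : ℝ} (hr : 1 < r) (hx : x ∈ Icc 0 (quarterPeriod r)) : gcos r x ≤ 1 := by
  have h := gsin_mem_Icc hr hx
  have h1 := Real.rpow_le_one h.1 h.2 (by linarith : 0 ≤ r)
  have h2 := Real.rpow_nonneg h.1 r
  exact Real.rpow_le_one (by linarith) (by linarith) (by positivity)

/-- This is the r-Laplace equation for the sine. Written as `(1 - gsin ^ r) ^ ((r - 1) / r)`, the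
power produces by the chain rule a factor `(1 - gsin ^ r) ^ (-1 / r)`, which cancels the factor
`gcos` coming from `gsin`. -/
lemma hasDerivAt_gcos_rpow {r x : ℝ} (hr : 1 < r) (hx : x ∈ Ioo 0 (quarterPeriod r)) :
    HasDerivAt (fun x => gcos r x ^ (r - 1)) (-((r - 1) * gsin r x ^ (r - 1))) x := by
  have hr0 : 0 < r := by linarith
  have hy := gsin_mem_Ioo hr hx
  have hm := one_sub_rpow_mem hr hy
  have h1 : HasDerivAt (fun x => 1 - gsin r x ^ r) (-(gcos r x * r * gsin r x ^ (r - 1))) x :=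
    ((hasDerivAt_gsin hr hx).rpow_const (Or.inl hy.1.ne')).const_sub 1
  have h2 := h1.rpow_const (p := (r - 1) / r) (Or.inl hm.1.ne')
  have h3 : (fun x => (1 - gsin r x ^ r) ^ ((r - 1) / r)) =ᶠ[𝓝 x] fun x => gcos r x ^ (r - 1) := by
    filter_upwards [isOpen_Ioo.mem_nhds hx] with y hy
    have hm' := one_sub_rpow_mem hr (gsin_mem_Ioo hr hy)
    rw [gcos, ← Real.rpow_mul hm'.1.le]
    congr 1
    ring
  refine (h2.congr_of_eventuallyEq h3.symm).congr_deriv ?_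
  have h4 : gcos r x * (1 - gsin r x ^ r) ^ ((r - 1) / r - 1) = 1 := by
    rw [gcos, ← Real.rpow_add hm.1]
    have : 1 / r + ((r - 1) / r - 1) = 0 := by field_simp; ring
    rw [this, Real.rpow_zero]
  calc _ = -(gcos r x * (1 - gsin r x ^ r) ^ ((r - 1) / r - 1)) * (gsin r x ^ (r - 1) *
        (r * ((r - 1) / r))) := by ring
    _ = _ := by rw [h4]; field_simp

/-! ### Concavity of the sine and estimates of the quarter period. -/

lemma arc_le_mul {r y : ℝ} (hr : 1 < r) (hy : y ∈ Icc (0 : ℝ) 1) :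
    arc r y ≤ y * quarterPeriod r := by
  -- Rescaling to (0, 1) reduces the claim to monotonicity of the density: its mean over (0, y) is
  -- at most its mean over (0, 1).
  have h := intervalIntegral.smul_integral_comp_mul_left (f := arcDensity r) (a := 0) (b := 1) y
  simp only [mul_zero, mul_one, smul_eq_mul] at h
  rw [arc, ← h]
  rcases hy.1.eq_or_lt with h0 | h0
  · simp [← h0]
  refine mul_le_mul_of_nonneg_left ?_ hy.1
  refine intervalIntegral.integral_mono_on_of_le_Ioo zero_le_one ?_
    (intervalIntegrable_arcDensity hr _ _) ?_
  · have := (intervalIntegrable_arcDensity hr 0 y).comp_mul_left (c := y)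
    simpa [h0.ne'] using this
  · intro x hx
    have hyx : y * x ≤ x := mul_le_of_le_one_left hx.1.le hy.2
    rw [arcDensity_of_mem hx, arcDensity_of_mem ⟨by have := hx.1; positivity, by linarith [hx.2]⟩]
    have hm := one_sub_rpow_mem hr hx
    refine Real.rpow_le_rpow_of_nonpos hm.1 ?_ ?_
    · have := Real.rpow_le_rpow (by have := hx.1; positivity) hyx (by linarith : 0 ≤ r)
      linarith
    · have : 0 < 1 / r := by positivity
      linarith

lemma le_gsin_mul {r x : ℝ} (hr : 1 < r) (hx : x ∈ Icc 0 (quarterPeriod r)) :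
    x ≤ gsin r x * quarterPeriod r := by
  simpa [arc_gsin hr] using arc_le_mul hr (gsin_mem_Icc hr hx)

lemma rpow_inv_lt_of_lt {q p s : ℝ} (hq : 1 < q) (hqp : q < p) (hs : s ∈ Ioo (0 : ℝ) 1) :
    (1 - s ^ q) ^ (1 / q) < (1 - s ^ p) ^ (1 / p) := by
  have h1 := one_sub_rpow_mem hq hs
  have h2 := one_sub_rpow_mem (hq.trans hqp) hs
  have h3 : s ^ p < s ^ q := Real.rpow_lt_rpow_of_exponent_gt hs.1 hs.2 hqp
  calc _ < (1 - s ^ q) ^ (1 / p) := Real.rpow_lt_rpow_of_exponent_gt h1.1 h1.2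
        (one_div_lt_one_div_of_lt (by linarith) hqp)
    _ ≤ _ := Real.rpow_le_rpow h1.1.le (by linarith) (by have := hq.trans hqp; positivity)

lemma quarterPeriod_anti {q p : ℝ} (hq : 1 < q) (hqp : q < p) :
    quarterPeriod p ≤ quarterPeriod q := by
  have hp := hq.trans hqp
  refine intervalIntegral.integral_mono_on_of_le_Ioo zero_le_one
    (intervalIntegrable_arcDensity hp _ _) (intervalIntegrable_arcDensity hq _ _) fun s hs => ?_
  have h1 := one_sub_rpow_mem hq hs
  have h2 := one_sub_rpow_mem hp hs
  rw [arcDensity_of_mem hs, arcDensity_of_mem hs, Real.rpow_neg h1.1.le, Real.rpow_neg h2.1.le]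
  exact inv_anti₀ (Real.rpow_pos_of_pos h1.1 _) (rpow_inv_lt_of_lt hq hqp hs).le

/-- Bernoulli gives `1 - s ^ r ≤ r * (1 - s)`, so the quarter period is at least the integral of `(r
* (1 - s)) ^ (-1 / r)`; times r - 1 that integral equals `r ^ (1 - 1 / r) ≥ 1`. -/
lemma one_le_sub_one_mul_quarterPeriod {r : ℝ} (hr : 1 < r) : 1 ≤ (r - 1) * quarterPeriod r := by
  have hr0 : 0 < r := by linarith
  have hlt : 1 / r < 1 := by rw [div_lt_one hr0]; exact hr
  have hI : IntervalIntegrable (fun x : ℝ => x ^ (-(1 / r))) volume 0 1 := by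
    apply intervalIntegral.intervalIntegrable_rpow'
    linarith
  have hI2 := (hI.comp_sub_left 1).symm
  simp only [sub_self, sub_zero] at hI2
  have h1 : ∫ s in (0 : ℝ)..1, r ^ (-(1 / r)) * (1 - s) ^ (-(1 / r)) ≤ quarterPeriod r := by
    refine intervalIntegral.integral_mono_on_of_le_Ioo zero_le_one
      (hI2.const_mul _) (intervalIntegrable_arcDensity hr _ _) fun s hs => ?_
    have hm := one_sub_rpow_mem hr hs
    rw [arcDensity_of_mem hs, ← Real.mul_rpow hr0.le (by linarith [hs.2])]
    refine Real.rpow_le_rpow_of_nonpos hm.1 ?_ (by have : 0 < 1 / r := by positivity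
                                                   linarith)
    have := one_add_mul_self_le_rpow_one_add (s := s - 1) (by linarith [hs.1]) hr.le
    rw [add_sub_cancel] at this
    linarith
  rw [intervalIntegral.integral_const_mul,
    intervalIntegral.integral_comp_sub_left (fun x : ℝ => x ^ (-(1 / r))) 1,
    sub_self, sub_zero, integral_rpow (Or.inl (by linarith)), Real.one_rpow,
    Real.zero_rpow (by linarith)] at h1
  have h2 : (r - 1) * (r ^ (-(1 / r)) * ((1 - 0) / (-(1 / r) + 1))) = r ^ (1 - 1 / r) := by
    rw [sub_eq_add_neg 1 (1 / r), Real.rpow_add hr0, Real.rpow_one]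
    have : r - 1 ≠ 0 := by linarith
    have : -1 + r ≠ 0 := by linarith
    field_simp
    ring
  have h3 : 1 ≤ r ^ (1 - 1 / r) := Real.one_le_rpow hr.le (by linarith)
  rw [← h2] at h3
  exact h3.trans (mul_le_mul_of_nonneg_left h1 (by linarith))

/-! ### The quarter wave on (0, l). -/

/-- The first quarter of the wave of amplitude `1` and period `4 * l` of the `r`-Laplacian. -/
noncomputable def quarterSin (r l x : ℝ) : ℝ := gsin r (quarterPeriod r / l * x)

/-- The derivative of `quarterSin`. -/
noncomputable def quarterCos (r l x : ℝ) : ℝ :=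
  quarterPeriod r / l * gcos r (quarterPeriod r / l * x)

/-- The eigenvalue belonging to `quarterSin`. -/
noncomputable def quarterEigenvalue (r l : ℝ) : ℝ := (r - 1) * (quarterPeriod r / l) ^ r

section QuarterWave

variable {r l : ℝ}

lemma quarterPeriod_div_pos (hr : 1 < r) (hl : 0 < l) : 0 < quarterPeriod r / l :=
  div_pos (by linarith [one_le_quarterPeriod hr]) hl

lemma quarterEigenvalue_pos (hr : 1 < r) (hl : 0 < l) : 0 < quarterEigenvalue r l :=
  mul_pos (by linarith) (Real.rpow_pos_of_pos (quarterPeriod_div_pos hr hl) _)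

lemma quarterPeriod_div_mul (hl : 0 < l) : quarterPeriod r / l * l = quarterPeriod r :=
  div_mul_cancel₀ _ hl.ne'

lemma continuous_quarterSin (hr : 1 < r) : Continuous (quarterSin r l) :=
  (continuous_gsin hr).comp (continuous_const.mul continuous_id)

lemma continuous_quarterCos (hr : 1 < r) : Continuous (quarterCos r l) :=
  continuous_const.mul ((continuous_gcos hr).comp (continuous_const.mul continuous_id))

lemma scaled_mem_Icc (hr : 1 < r) (hl : 0 < l) {x : ℝ} (hx : x ∈ Icc 0 l) :
    quarterPeriod r / l * x ∈ Icc 0 (quarterPeriod r) := by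
  have h := quarterPeriod_div_pos hr hl
  refine ⟨mul_nonneg h.le hx.1, ?_⟩
  have := mul_le_mul_of_nonneg_left hx.2 h.le
  rwa [quarterPeriod_div_mul hl] at this

lemma scaled_mem_Ico (hr : 1 < r) (hl : 0 < l) {x : ℝ} (hx : x ∈ Ico 0 l) :
    quarterPeriod r / l * x ∈ Ico 0 (quarterPeriod r) := by
  have h := quarterPeriod_div_pos hr hl
  refine ⟨mul_nonneg h.le hx.1, ?_⟩
  have := mul_lt_mul_of_pos_left hx.2 h
  rwa [quarterPeriod_div_mul hl] at this

lemma scaled_mem_Ioo (hr : 1 < r) (hl : 0 < l) {x : ℝ} (hx : x ∈ Ioo 0 l) :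
    quarterPeriod r / l * x ∈ Ioo 0 (quarterPeriod r) :=
  ⟨mul_pos (quarterPeriod_div_pos hr hl) hx.1, (scaled_mem_Ico hr hl ⟨hx.1.le, hx.2⟩).2⟩

lemma quarterSin_zero (hr : 1 < r) : quarterSin r l 0 = 0 := by
  simp [quarterSin, gsin_zero hr]

lemma quarterSin_self (hr : 1 < r) (hl : 0 < l) : quarterSin r l l = 1 := by
  simp [quarterSin, quarterPeriod_div_mul hl, gsin_quarterPeriod hr]

lemma quarterSin_mem_Ioo (hr : 1 < r) (hl : 0 < l) {x : ℝ} (hx : x ∈ Ioo 0 l) :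
    quarterSin r l x ∈ Ioo (0 : ℝ) 1 := gsin_mem_Ioo hr (scaled_mem_Ioo hr hl hx)

lemma quarterSin_nonneg (hr : 1 < r) (hl : 0 < l) {x : ℝ} (hx : x ∈ Icc 0 l) :
    0 ≤ quarterSin r l x := (gsin_mem_Icc hr (scaled_mem_Icc hr hl hx)).1

lemma div_le_quarterSin (hr : 1 < r) (hl : 0 < l) {x : ℝ} (hx : x ∈ Icc 0 l) :
    x / l ≤ quarterSin r l x := by
  have h := le_gsin_mul hr (scaled_mem_Icc hr hl hx)
  have hL : 0 < quarterPeriod r := by linarith [one_le_quarterPeriod hr]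
  rw [quarterSin]
  refine le_of_mul_le_mul_right (le_trans (le_of_eq ?_) h) hL
  ring

lemma quarterCos_pos (hr : 1 < r) (hl : 0 < l) {x : ℝ} (hx : x ∈ Ico 0 l) :
    0 < quarterCos r l x :=
  mul_pos (quarterPeriod_div_pos hr hl) (gcos_pos hr (scaled_mem_Ico hr hl hx))

lemma quarterCos_self (hr : 1 < r) (hl : 0 < l) : quarterCos r l l = 0 := by
  simp [quarterCos, quarterPeriod_div_mul hl, gcos_quarterPeriod hr]

lemma quarterCos_nonneg (hr : 1 < r) (hl : 0 < l) {x : ℝ} (hx : x ∈ Icc 0 l) :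
    0 ≤ quarterCos r l x := by
  rcases hx.2.eq_or_lt with h | h
  · rw [h, quarterCos_self hr hl]
  · exact (quarterCos_pos hr hl ⟨hx.1, h⟩).le

lemma quarterCos_le (hr : 1 < r) (hl : 0 < l) {x : ℝ} (hx : x ∈ Icc 0 l) :
    quarterCos r l x ≤ quarterPeriod r / l :=
  mul_le_of_le_one_right (quarterPeriod_div_pos hr hl).le
    (gcos_le_one hr (scaled_mem_Icc hr hl hx))

lemma hasDerivAt_quarterSin (hr : 1 < r) (hl : 0 < l) {x : ℝ} (hx : x ∈ Ioo 0 l) :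
    HasDerivAt (quarterSin r l) (quarterCos r l x) x := by
  have h := (hasDerivAt_gsin hr (scaled_mem_Ioo hr hl hx)).comp x
    ((hasDerivAt_id x).const_mul (quarterPeriod r / l))
  refine h.congr_deriv ?_
  simp [quarterCos, mul_comm]

lemma integral_quarterCos (hr : 1 < r) (hl : 0 < l) {x : ℝ} (hx : x ∈ Icc 0 l) :
    ∫ t in (0 : ℝ)..x, quarterCos r l t = quarterSin r l x := by
  rw [intervalIntegral.integral_eq_sub_of_hasDerivAt_of_le hx.1
    (continuous_quarterSin hr).continuousOn
    (fun t ht => hasDerivAt_quarterSin hr hl ⟨ht.1, ht.2.trans_le hx.2⟩)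
    ((continuous_quarterCos hr).intervalIntegrable _ _), quarterSin_zero hr, sub_zero]

lemma continuous_quarterSin_rpow (hr : 1 < r) :
    Continuous fun x => quarterSin r l x ^ (r - 1) :=
  (continuous_quarterSin hr).rpow_const fun _ => Or.inr (by linarith)

lemma hasDerivAt_quarterCos_rpow (hr : 1 < r) (hl : 0 < l) {x : ℝ} (hx : x ∈ Ioo 0 l) :
    HasDerivAt (fun x => quarterCos r l x ^ (r - 1))
      (-(quarterEigenvalue r l * quarterSin r l x ^ (r - 1))) x := by
  have hm := quarterPeriod_div_pos hr hl
  have h := ((hasDerivAt_gcos_rpow hr (scaled_mem_Ioo hr hl hx)).comp x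
    ((hasDerivAt_id x).const_mul (quarterPeriod r / l))).const_mul
      ((quarterPeriod r / l) ^ (r - 1))
  refine (h.congr_of_eventuallyEq ?_).congr_deriv ?_
  · filter_upwards [isOpen_Ioo.mem_nhds hx] with y hy
    rw [quarterCos, Real.mul_rpow hm.le
      (gcos_pos hr (Ioo_subset_Ico_self (scaled_mem_Ioo hr hl hy))).le]
    simp
  · have : (quarterPeriod r / l) ^ r = (quarterPeriod r / l) ^ (r - 1) * (quarterPeriod r / l) := by
      rw [← Real.rpow_add_one hm.ne', sub_add_cancel]
    rw [quarterEigenvalue, this, quarterSin]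
    ring

/-- Integrated form of the eigenvalue equation, using that the cosine vanishes at l. It is the
identity that cancels the weights after the exchange of integrals. -/
lemma integral_quarterSin_rpow (hr : 1 < r) (hl : 0 < l) {t : ℝ} (ht : t ∈ Icc 0 l) :
    ∫ x in t..l, quarterEigenvalue r l * quarterSin r l x ^ (r - 1)
      = quarterCos r l t ^ (r - 1) := by
  have hc : Continuous fun x => quarterCos r l x ^ (r - 1) :=
    (continuous_quarterCos hr).rpow_const fun _ => Or.inr (by linarith)
  have h := intervalIntegral.integral_eq_sub_of_hasDerivAt_of_le ht.2 hc.continuousOn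
    (fun x hx => hasDerivAt_quarterCos_rpow hr hl ⟨ht.1.trans_lt hx.1, hx.2⟩)
    (((continuous_quarterSin_rpow hr).const_mul (quarterEigenvalue r l)).neg.intervalIntegrable _ _)
  rw [intervalIntegral.integral_neg, quarterCos_self hr hl, Real.zero_rpow (by linarith)] at h
  linarith

end QuarterWave

/-! ### Tangent line inequality, and Fubini on a triangle. -/

lemma tangent_le_abs_rpow {r : ℝ} (hr : 1 < r) (a c : ℝ) :
    |c| ^ r + r * (|c| ^ (r - 2) * c) * (a - c) ≤ |a| ^ r ∧
      (|c| ^ r + r * (|c| ^ (r - 2) * c) * (a - c) = |a| ^ r → a = c) := by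
  have hr0 : 0 < r := by linarith
  rcases eq_or_ne c 0 with rfl | hc
  · simp only [abs_zero, Real.zero_rpow hr0.ne', mul_zero, zero_mul, add_zero]
    refine ⟨by positivity, fun h => ?_⟩
    by_contra ha
    have := Real.rpow_pos_of_pos (abs_pos.2 ha) r
    linarith
  -- By homogeneity the claim is the strict Bernoulli inequality for t ≠ 1; for t < 0 its left side
  -- is already negative.
  · obtain ⟨t, rfl⟩ : ∃ t, a = c * t := ⟨a / c, by field_simp⟩
    have hc' := abs_pos.2 hc
    have hcr := Real.rpow_pos_of_pos hc' r
    have h1 : |c| ^ (r - 2) * c * c = |c| ^ r := by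
      rw [mul_assoc, ← abs_mul_abs_self, ← pow_two, ← Real.rpow_natCast, ← Real.rpow_add hc']
      norm_num
    have h2 : |c| ^ r + r * (|c| ^ (r - 2) * c) * (c * t - c) = |c| ^ r * (1 + r * (t - 1)) := by
      rw [← h1]; ring
    rw [h2, abs_mul, Real.mul_rpow hc'.le (abs_nonneg _)]
    have key : t ≠ 1 → 1 + r * (t - 1) < |t| ^ r := by
      intro ht
      rcases le_or_gt 0 t with h0 | h0
      · have := one_add_mul_self_lt_rpow_one_add (s := t - 1) (by linarith) (sub_ne_zero.2 ht) hr
        rw [add_sub_cancel] at this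
        rwa [abs_of_nonneg h0]
      · have : 0 ≤ |t| ^ r := by positivity
        nlinarith
    rcases eq_or_ne t 1 with rfl | ht
    · simp
    · have := mul_lt_mul_of_pos_left (key ht) hcr
      exact ⟨this.le, fun h => absurd h this.ne⟩

/-- Fubini over t < x. Integrability is asked only of the product with the inner integral of `a`,
not of `b`: in the main use `b` carries the weight `quarterCos ^ (1 - r)`, which blows up at l.
Nonnegativity of `a` turns that hypothesis into absolute integrability on the triangle. -/
lemma triangle_swap {l : ℝ} (hl : 0 < l) {a b : ℝ → ℝ} (ha : IntegrableOn a (Ioo 0 l))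
    (ha0 : ∀ x ∈ Ioo 0 l, 0 ≤ a x) (hb : AEStronglyMeasurable b (volume.restrict (Ioo 0 l)))
    (hab : IntegrableOn (fun t => (∫ x in t..l, a x) * b t) (Ioo 0 l)) :
    IntegrableOn (fun x => a x * ∫ t in (0 : ℝ)..x, b t) (Ioo 0 l) ∧
      ∫ x in (0 : ℝ)..l, a x * ∫ t in (0 : ℝ)..x, b t
        = ∫ t in (0 : ℝ)..l, (∫ x in t..l, a x) * b t := by
  set μ := volume.restrict (Ioo 0 l) with hμ
  have hS : MeasurableSet {z : ℝ × ℝ | z.2 < z.1} := measurableSet_lt measurable_snd measurable_fst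
  let f : ℝ → ℝ → ℝ := fun x t => {z : ℝ × ℝ | z.2 < z.1}.indicator (fun z => a z.1 * b z.2) (x, t)
  have hf : ∀ x t, f x t = if t < x then a x * b t else 0 := fun x t => by
    simp [f, indicator_apply]
  have hfm : AEStronglyMeasurable (Function.uncurry f) (μ.prod μ) :=
    (ha.aestronglyMeasurable.comp_fst.mul hb.comp_snd).indicator hS
  have hinner : ∀ t ∈ Ioo 0 l, ∀ (h : ℝ → ℝ),
      ∫ x, (Ioi t).indicator h x ∂μ = ∫ x in t..l, h x := by
    intro t ht h
    rw [integral_indicator measurableSet_Ioi, hμ, Measure.restrict_restrict measurableSet_Ioi,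
      intervalIntegral.integral_of_le ht.2.le, integral_Ioc_eq_integral_Ioo]
    congr 2
    ext x
    simp only [mem_inter_iff, mem_Ioi, mem_Ioo]
    exact ⟨fun h => ⟨h.1, h.2.2⟩, fun h => ⟨h.1, ht.1.trans h.1, h.2⟩⟩
  have h1 : ∀ t ∈ Ioo 0 l, ∫ x, f x t ∂μ = (∫ x in t..l, a x) * b t := by
    intro t ht
    rw [← intervalIntegral.integral_mul_const, ← hinner t ht]
    congr 1
  have h1n : ∀ t ∈ Ioo 0 l, ∫ x, ‖f x t‖ ∂μ = ‖(∫ x in t..l, a x) * b t‖ := by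
    intro t ht
    have hA : 0 ≤ ∫ x in t..l, a x := by
      refine intervalIntegral.integral_nonneg_of_ae_restrict ht.2.le ?_
      rw [← restrict_Ioo_eq_restrict_Icc]
      exact (ae_restrict_iff' measurableSet_Ioo).2
        (ae_of_all _ fun x hx => ha0 x ⟨ht.1.trans hx.1, hx.2⟩)
    rw [norm_mul, Real.norm_of_nonneg hA, ← intervalIntegral.integral_mul_const, ← hinner t ht]
    refine integral_congr_ae ((ae_restrict_iff' measurableSet_Ioo).2 (ae_of_all _ fun x hx => ?_))
    simp only [hf, indicator_apply, mem_Ioi]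
    split_ifs
    · rw [norm_mul, Real.norm_of_nonneg (ha0 x hx)]
    · simp
  have h2 : ∀ x ∈ Ioo 0 l, ∫ t, f x t ∂μ = a x * ∫ t in (0 : ℝ)..x, b t := by
    intro x hx
    rw [← intervalIntegral.integral_const_mul, intervalIntegral.integral_of_le hx.1.le,
      integral_Ioc_eq_integral_Ioo]
    have : Ioo 0 x = Iio x ∩ Ioo 0 l := by
      ext t
      simp only [mem_inter_iff, mem_Iio, mem_Ioo]
      exact ⟨fun h => ⟨h.2, h.1, h.2.trans hx.2⟩, fun h => ⟨h.2.1, h.1⟩⟩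
    rw [this, ← Measure.restrict_restrict measurableSet_Iio, ← hμ,
      ← integral_indicator measurableSet_Iio]
    congr 1
  have hint : Integrable (Function.uncurry f) (μ.prod μ) := by
    refine (integrable_prod_iff' hfm).2 ⟨?_, ?_⟩
    · refine ae_of_all _ fun t => ?_
      have : (fun x => Function.uncurry f (x, t)) = (Ioi t).indicator fun x => a x * b t := by
        ext x
        simp [Function.uncurry, hf, indicator_apply]
      rw [this]
      exact (ha.mul_const (b t)).indicator measurableSet_Ioi
    · refine hab.norm.congr ((ae_restrict_iff' measurableSet_Ioo).2 (ae_of_all _ fun t ht => ?_))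
      exact (h1n t ht).symm
  constructor
  · refine hint.integral_prod_left.congr
      ((ae_restrict_iff' measurableSet_Ioo).2 (ae_of_all _ fun x hx => ?_))
    exact h2 x hx
  · have := integral_integral_swap hint
    rw [intervalIntegral.integral_of_le hl.le, intervalIntegral.integral_of_le hl.le,
      integral_Ioc_eq_integral_Ioo, integral_Ioc_eq_integral_Ioo,
      ← setIntegral_congr_fun measurableSet_Ioo h2, ← setIntegral_congr_fun measurableSet_Ioo h1]
    exact this

lemma intervalIntegrable_of_integrableOn_Ioo {f : ℝ → ℝ} {a b c d : ℝ}
    (h : IntegrableOn f (Ioo a b)) (hac : a ≤ c) (hcd : c ≤ d) (hdb : d ≤ b) :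
    IntervalIntegrable f volume c d :=
  (intervalIntegrable_iff_integrableOn_Ioo_of_le hcd).2 (h.mono_set (Ioo_subset_Ioo hac hdb))

lemma continuousOn_primitive_of_integrableOn {g : ℝ → ℝ} {l : ℝ}
    (hg : IntegrableOn g (Ioo 0 l)) :
    ContinuousOn (fun x => ∫ t in (0 : ℝ)..x, g t) (Icc 0 l) :=
  intervalIntegral.continuousOn_primitive
    ((integrableOn_Icc_iff_integrableOn_Ioo).2 hg) |>.congr fun x hx =>
      intervalIntegral.integral_of_le hx.1

/-! ### Sharp Poincaré inequality with one vanishing endpoint. -/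

section HalfProblem

variable {r l : ℝ} {g : ℝ → ℝ}

/-- The weighted energy of `g` on `(0, x)`. -/
noncomputable def weightedEnergy (r l : ℝ) (g : ℝ → ℝ) (x : ℝ) : ℝ :=
  ∫ t in (0 : ℝ)..x, |g t| ^ r * (quarterCos r l t ^ (r - 1))⁻¹

/-- Jensen's inequality for the weight k = `quarterCos` on (0, x), whose total mass is `quarterSin r
l x`. The tangent inequality is applied to g / k at its weighted mean c and multiplied by k; the
remainder `e` is nonnegative and vanishes only where g = c k. -/
lemma abs_primitive_rpow_le (hr : 1 < r) (hl : 0 < l) (hg : IntegrableOn g (Ioo 0 l))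
    (hgr : IntegrableOn (fun t => |g t| ^ r) (Ioo 0 l)) {x : ℝ} (hx : x ∈ Ioo 0 l) :
    |∫ t in (0 : ℝ)..x, g t| ^ r ≤ quarterSin r l x ^ (r - 1) * weightedEnergy r l g x ∧
    (|∫ t in (0 : ℝ)..x, g t| ^ r = quarterSin r l x ^ (r - 1) * weightedEnergy r l g x →
      ∀ᵐ t ∂(volume.restrict (Ioo 0 x)),
        g t = (∫ t in (0 : ℝ)..x, g t) / quarterSin r l x * quarterCos r l t) := by
  set s := quarterSin r l x with hs
  set U := ∫ t in (0 : ℝ)..x, g t with hU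
  obtain ⟨c, hc⟩ : ∃ c, c = U / s := ⟨_, rfl⟩
  rw [← hc]
  have hs0 : 0 < s := (quarterSin_mem_Ioo hr hl hx).1
  have hk : ∀ t ∈ Icc 0 x, 0 < quarterCos r l t := fun t ht =>
    quarterCos_pos hr hl ⟨ht.1, ht.2.trans_lt hx.2⟩
  have hg' := intervalIntegrable_of_integrableOn_Ioo hg le_rfl hx.1.le hx.2.le
  have hgr' := intervalIntegrable_of_integrableOn_Ioo hgr le_rfl hx.1.le hx.2.le
  have hI1 : IntervalIntegrable (fun t => |g t| ^ r * (quarterCos r l t ^ (r - 1))⁻¹) volume 0 x := by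
    refine hgr'.mul_continuousOn ?_
    rw [uIcc_of_le hx.1.le]
    refine ContinuousOn.inv₀ ?_ fun t ht => (Real.rpow_pos_of_pos (hk t ht) _).ne'
    exact ((continuous_quarterCos hr).rpow_const fun _ => Or.inr (by linarith)).continuousOn
  have hI2 := (continuous_quarterCos (r := r) (l := l) hr).intervalIntegrable (μ := volume) 0 x
  set e : ℝ → ℝ := fun t => |g t| ^ r * (quarterCos r l t ^ (r - 1))⁻¹
    - (|c| ^ r * quarterCos r l t
      + r * (|c| ^ (r - 2) * c) * (g t - c * quarterCos r l t)) with he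
  have heI : IntervalIntegrable e volume 0 x :=
    hI1.sub ((hI2.const_mul _).add ((hg'.sub (hI2.const_mul c)).const_mul _))
  have hpt : ∀ t ∈ Ioo 0 x, 0 ≤ e t ∧ (e t = 0 → g t = c * quarterCos r l t) := by
    intro t ht
    have hkt := hk t (Ioo_subset_Icc_self ht)
    obtain ⟨h1, h2⟩ := tangent_le_abs_rpow hr (g t / quarterCos r l t) c
    have h3 : e t = quarterCos r l t * (|g t / quarterCos r l t| ^ r -
        (|c| ^ r + r * (|c| ^ (r - 2) * c) * (g t / quarterCos r l t - c))) := by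
      simp only [he]
      rw [abs_div, abs_of_pos hkt, Real.div_rpow (abs_nonneg _) hkt.le, Real.rpow_sub_one hkt.ne']
      have := (Real.rpow_pos_of_pos hkt r).ne'
      field_simp
    rw [h3]
    refine ⟨mul_nonneg hkt.le (by linarith), fun h => ?_⟩
    have h4 := h2 (by
      rcases mul_eq_zero.1 h with h | h
      · exact absurd h hkt.ne'
      · linarith)
    rw [← h4]
    field_simp
  have hint : ∫ t in (0 : ℝ)..x, e t = weightedEnergy r l g x - |c| ^ r * s := by
    rw [intervalIntegral.integral_sub hI1
      ((hI2.const_mul _).add ((hg'.sub (hI2.const_mul c)).const_mul _)),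
      intervalIntegral.integral_add (hI2.const_mul _) ((hg'.sub (hI2.const_mul c)).const_mul _),
      intervalIntegral.integral_const_mul, intervalIntegral.integral_const_mul,
      intervalIntegral.integral_sub hg' (hI2.const_mul c), intervalIntegral.integral_const_mul,
      integral_quarterCos hr hl (Ioo_subset_Icc_self hx), ← hs, ← hU]
    -- The linear term of the tangent integrates to zero because c is the weighted mean.
    have : U - c * s = 0 := by rw [hc]; field_simp; ring
    rw [this]
    simp [weightedEnergy]
  have hUc : |U| ^ r = s ^ (r - 1) * (|c| ^ r * s) := by
    rw [hc, abs_div, abs_of_pos hs0, Real.div_rpow (abs_nonneg _) hs0.le, Real.rpow_sub_one hs0.ne']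
    have := (Real.rpow_pos_of_pos hs0 r).ne'
    field_simp
  have hsr := Real.rpow_pos_of_pos hs0 (r - 1)
  have hae : ∀ᵐ t ∂(volume.restrict (Ioo 0 x)), 0 ≤ e t :=
    (ae_restrict_iff' measurableSet_Ioo).2 (ae_of_all _ fun t ht => (hpt t ht).1)
  rw [intervalIntegral.integral_of_le hx.1.le, integral_Ioc_eq_integral_Ioo] at hint
  constructor
  · rw [hUc]
    refine mul_le_mul_of_nonneg_left ?_ hsr.le
    have := integral_nonneg_of_ae hae
    linarith
  · intro h
    rw [hUc] at h
    have h1 := mul_left_cancel₀ hsr.ne' h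
    have h2 : ∫ t in Ioo 0 x, e t = 0 := by rw [hint]; linarith
    have h3 := (integral_eq_zero_iff_of_nonneg_ae hae
      ((intervalIntegrable_iff_integrableOn_Ioo_of_le hx.1.le).1 heI)).1 h2
    filter_upwards [h3, ae_restrict_mem measurableSet_Ioo] with t ht htm
    exact (hpt t htm).2 ht

lemma integral_weightedEnergy (hr : 1 < r) (hl : 0 < l)
    (hgr : IntegrableOn (fun t => |g t| ^ r) (Ioo 0 l)) :
    IntegrableOn (fun x => quarterEigenvalue r l * quarterSin r l x ^ (r - 1)
      * weightedEnergy r l g x) (Ioo 0 l) ∧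
    ∫ x in (0 : ℝ)..l, quarterEigenvalue r l * quarterSin r l x ^ (r - 1)
      * weightedEnergy r l g x = ∫ t in (0 : ℝ)..l, |g t| ^ r := by
  have hpt : ∀ t ∈ Ioo 0 l, (∫ x in t..l, quarterEigenvalue r l * quarterSin r l x ^ (r - 1)) *
      (|g t| ^ r * (quarterCos r l t ^ (r - 1))⁻¹) = |g t| ^ r := by
    intro t ht
    rw [integral_quarterSin_rpow hr hl (Ioo_subset_Icc_self ht)]
    have := (Real.rpow_pos_of_pos (quarterCos_pos hr hl (Ioo_subset_Ico_self ht)) (r - 1)).ne'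
    field_simp
  have h := triangle_swap hl
    (a := fun x => quarterEigenvalue r l * quarterSin r l x ^ (r - 1))
    (b := fun t => |g t| ^ r * (quarterCos r l t ^ (r - 1))⁻¹)
    (((continuous_quarterSin_rpow hr).const_mul _).continuousOn.integrableOn_Icc.mono_set
      Ioo_subset_Icc_self)
    (fun x hx => mul_nonneg (quarterEigenvalue_pos hr hl).le
      (Real.rpow_nonneg (quarterSin_nonneg hr hl (Ioo_subset_Icc_self hx)) _))
    (hgr.aestronglyMeasurable.mul (((continuous_quarterCos hr).rpow_const fun _ =>
      Or.inr (by linarith)).measurable.inv.aestronglyMeasurable))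
    (hgr.congr_fun (fun t ht => (hpt t ht).symm) measurableSet_Ioo)
  refine ⟨h.1, h.2.trans ?_⟩
  rw [intervalIntegral.integral_of_le hl.le, intervalIntegral.integral_of_le hl.le,
      integral_Ioc_eq_integral_Ioo, integral_Ioc_eq_integral_Ioo]
  exact setIntegral_congr_fun measurableSet_Ioo hpt

lemma integrableOn_abs_primitive_rpow (hr : 1 < r) (hg : IntegrableOn g (Ioo 0 l)) :
    IntegrableOn (fun x => |∫ t in (0 : ℝ)..x, g t| ^ r) (Ioo 0 l) := by
  refine IntegrableOn.mono_set (ContinuousOn.integrableOn_Icc ?_) Ioo_subset_Icc_self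
  exact (continuousOn_primitive_of_integrableOn hg).abs.rpow_const
    fun _ _ => Or.inr (by linarith)

theorem quarterEigenvalue_mul_le (hr : 1 < r) (hl : 0 < l) (hg : IntegrableOn g (Ioo 0 l))
    (hgr : IntegrableOn (fun t => |g t| ^ r) (Ioo 0 l)) :
    quarterEigenvalue r l * ∫ x in (0 : ℝ)..l, |∫ t in (0 : ℝ)..x, g t| ^ r
      ≤ ∫ t in (0 : ℝ)..l, |g t| ^ r := by
  obtain ⟨h1, h2⟩ := integral_weightedEnergy hr hl hgr
  rw [← h2, ← intervalIntegral.integral_const_mul]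
  refine intervalIntegral.integral_mono_on_of_le_Ioo hl.le
    (intervalIntegrable_of_integrableOn_Ioo ((integrableOn_abs_primitive_rpow hr hg).const_mul _)
      le_rfl hl.le le_rfl)
    (intervalIntegrable_of_integrableOn_Ioo h1 le_rfl hl.le le_rfl) fun x hx => ?_
  rw [mul_assoc]
  exact mul_le_mul_of_nonneg_left (abs_primitive_rpow_le hr hl hg hgr hx).1
    (quarterEigenvalue_pos hr hl).le

lemma eq_of_ae_eq_mul_quarterCos (hr : 1 < r) (hl : 0 < l) {c x : ℝ} (hx : x ∈ Icc 0 l)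
    (h : ∀ᵐ t ∂(volume.restrict (Ioo 0 x)), g t = c * quarterCos r l t) :
    ∫ t in (0 : ℝ)..x, g t = c * quarterSin r l x := by
  rw [← integral_quarterCos hr hl hx, ← intervalIntegral.integral_const_mul,
    intervalIntegral.integral_of_le hx.1, intervalIntegral.integral_of_le hx.1,
    integral_Ioc_eq_integral_Ioo, integral_Ioc_eq_integral_Ioo]
  exact integral_congr_ae h

theorem ae_eq_of_quarterEigenvalue_mul_eq (hr : 1 < r) (hl : 0 < l)
    (hg : IntegrableOn g (Ioo 0 l)) (hgr : IntegrableOn (fun t => |g t| ^ r) (Ioo 0 l))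
    (heq : quarterEigenvalue r l * ∫ x in (0 : ℝ)..l, |∫ t in (0 : ℝ)..x, g t| ^ r
      = ∫ t in (0 : ℝ)..l, |g t| ^ r) :
    ∃ c, ∀ᵐ t ∂(volume.restrict (Ioo 0 l)), g t = c * quarterCos r l t := by
  obtain ⟨h1, h2⟩ := integral_weightedEnergy hr hl hgr
  have hΛ := quarterEigenvalue_pos hr hl
  have h0 := (integrableOn_abs_primitive_rpow hr hg).const_mul (quarterEigenvalue r l)
  rw [← h2, ← intervalIntegral.integral_const_mul, intervalIntegral.integral_of_le hl.le,
    intervalIntegral.integral_of_le hl.le, integral_Ioc_eq_integral_Ioo,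
    integral_Ioc_eq_integral_Ioo] at heq
  have h3 := (integral_eq_iff_of_ae_le h0 h1 ((ae_restrict_iff' measurableSet_Ioo).2
    (ae_of_all _ fun x hx => by
      simp only
      rw [mul_assoc]
      exact mul_le_mul_of_nonneg_left (abs_primitive_rpow_le hr hl hg hgr hx).1 hΛ.le))).1 heq
  have h4 : ∀ᵐ x ∂(volume.restrict (Ioo 0 l)), ∀ᵐ t ∂(volume.restrict (Ioo 0 x)),
      g t = (∫ t in (0 : ℝ)..x, g t) / quarterSin r l x * quarterCos r l t := by
    filter_upwards [h3, ae_restrict_mem measurableSet_Ioo] with x hx hxm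
    refine (abs_primitive_rpow_le hr hl hg hgr hxm).2 ?_
    rw [mul_assoc] at hx
    exact mul_left_cancel₀ hΛ.ne' hx
  -- For almost every x, g is proportional to the cosine on (0, x), with a factor that may depend on
  -- x. Good points x exist arbitrarily close to l, and all factors agree with the one at a fixed
  -- x₀, as both describe g on (0, x₀).
  rw [ae_restrict_iff' measurableSet_Ioo] at h4
  have hex : ∀ y ∈ Ico 0 l, ∃ x ∈ Ioo y l, ∀ᵐ t ∂(volume.restrict (Ioo 0 x)),
      g t = (∫ t in (0 : ℝ)..x, g t) / quarterSin r l x * quarterCos r l t := by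
    intro y hy
    have hne : ∃ᵐ x ∂(volume : Measure ℝ), x ∈ Ioo y l := by
      rw [frequently_ae_mem_iff]
      simp [hy.2]
    obtain ⟨x, hx, hx'⟩ := (hne.and_eventually h4).exists
    exact ⟨x, hx, hx' ⟨hy.1.trans_lt hx.1, hx.2⟩⟩
  obtain ⟨x₀, hx₀, hc₀⟩ := hex 0 ⟨le_rfl, hl⟩
  refine ⟨(∫ t in (0 : ℝ)..x₀, g t) / quarterSin r l x₀, ?_⟩
  have hs₀ := (quarterSin_mem_Ioo hr hl hx₀).1
  have hstep : ∀ y ∈ Ico x₀ l, ∀ᵐ t ∂(volume.restrict (Ioo 0 y)),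
      g t = (∫ t in (0 : ℝ)..x₀, g t) / quarterSin r l x₀ * quarterCos r l t := by
    intro y hy
    obtain ⟨x, hx, hcx⟩ := hex y ⟨hx₀.1.le.trans hy.1, hy.2⟩
    have h5 := eq_of_ae_eq_mul_quarterCos hr hl (Ioo_subset_Icc_self hx₀)
      (ae_restrict_of_ae_restrict_of_subset
        (Ioo_subset_Ioo_right (hy.1.trans hx.1.le)) hcx)
    rw [h5, mul_div_cancel_right₀ _ hs₀.ne']
    exact ae_restrict_of_ae_restrict_of_subset (Ioo_subset_Ioo_right hx.1.le) hcx
  obtain ⟨u, -, hu, hul⟩ := exists_seq_strictMono_tendsto' hx₀.2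
  have hU : Ioo 0 l = ⋃ n, Ioo 0 (u n) := by
    ext t
    simp only [mem_iUnion, mem_Ioo, exists_and_left]
    refine ⟨fun h => ⟨h.1, ?_⟩, fun ⟨h, n, hn⟩ => ⟨h, hn.trans (hu n).2⟩⟩
    exact (hul.eventually (lt_mem_nhds h.2)).exists
  rw [hU, ae_restrict_iUnion_iff]
  exact fun n => hstep _ ⟨(hu n).1.le, (hu n).2⟩

/-- Weak form of the eigenvalue equation on the half interval; Fubini on the triangle takes the
place of integration by parts. -/
lemma integral_quarterCos_rpow_mul (hr : 1 < r) (hl : 0 < l) (hg : IntegrableOn g (Ioo 0 l)) :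
    ∫ t in (0 : ℝ)..l, quarterCos r l t ^ (r - 1) * g t
      = quarterEigenvalue r l * ∫ x in (0 : ℝ)..l, quarterSin r l x ^ (r - 1)
        * ∫ t in (0 : ℝ)..x, g t := by
  have hpt : ∀ t ∈ Ioo 0 l, (∫ x in t..l, quarterEigenvalue r l * quarterSin r l x ^ (r - 1)) *
      g t = quarterCos r l t ^ (r - 1) * g t := by
    intro t ht
    rw [integral_quarterSin_rpow hr hl (Ioo_subset_Icc_self ht)]
  have hI : IntegrableOn (fun t => quarterCos r l t ^ (r - 1) * g t) (Ioo 0 l) :=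
    (intervalIntegrable_iff_integrableOn_Ioo_of_le hl.le).1
      ((intervalIntegrable_of_integrableOn_Ioo hg le_rfl hl.le le_rfl).continuousOn_mul
        ((continuous_quarterCos hr).rpow_const fun _ => Or.inr (by linarith)).continuousOn)
  have h := triangle_swap hl
    (a := fun x => quarterEigenvalue r l * quarterSin r l x ^ (r - 1)) (b := g)
    (((continuous_quarterSin_rpow hr).const_mul _).continuousOn.integrableOn_Icc.mono_set
      Ioo_subset_Icc_self)
    (fun x hx => mul_nonneg (quarterEigenvalue_pos hr hl).le
      (Real.rpow_nonneg (quarterSin_nonneg hr hl (Ioo_subset_Icc_self hx)) _))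
    hg.aestronglyMeasurable
    (hI.congr_fun (fun t ht => (hpt t ht).symm) measurableSet_Ioo)
  rw [← intervalIntegral.integral_const_mul]
  simp only [mul_assoc] at h
  rw [h.2, intervalIntegral.integral_of_le hl.le, intervalIntegral.integral_of_le hl.le,
      integral_Ioc_eq_integral_Ioo, integral_Ioc_eq_integral_Ioo]
  exact (setIntegral_congr_fun measurableSet_Ioo hpt).symm

end HalfProblem

/-! ### Dirichlet inequality on an interval, by folding at the midpoint. -/

section Dirichlet

variable {r a b : ℝ} {g : ℝ → ℝ}

lemma integral_eq_add_halves {f : ℝ → ℝ} (hab : a ≤ b) (hf : IntegrableOn f (Ioo a b)) :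
    ∫ x in a..b, f x = (∫ t in (0 : ℝ)..(b - a) / 2, f (a + t))
      + ∫ t in (0 : ℝ)..(b - a) / 2, f (b - t) := by
  rw [intervalIntegral.integral_comp_add_left (fun x => f x) a,
    intervalIntegral.integral_comp_sub_left (fun x => f x) b]
  have h1 : a + (b - a) / 2 = (a + b) / 2 := by ring
  have h2 : b - (b - a) / 2 = (a + b) / 2 := by ring
  rw [h1, h2, add_zero, sub_zero]
  exact (intervalIntegral.integral_add_adjacent_intervals
    (intervalIntegrable_of_integrableOn_Ioo hf le_rfl (by linarith) (by linarith))
    (intervalIntegrable_of_integrableOn_Ioo hf (by linarith) (by linarith) le_rfl)).symm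

lemma integrableOn_comp_add_half {f : ℝ → ℝ} (hab : a ≤ b) (hf : IntegrableOn f (Ioo a b)) :
    IntegrableOn (fun t => f (a + t)) (Ioo 0 ((b - a) / 2)) := by
  have h := (intervalIntegrable_of_integrableOn_Ioo hf le_rfl
    (by linarith : a ≤ a + (b - a) / 2) (by linarith)).comp_add_left a
  rw [sub_self, add_sub_cancel_left] at h
  exact (intervalIntegrable_iff_integrableOn_Ioo_of_le (by linarith)).1 h

lemma integrableOn_comp_sub_half {f : ℝ → ℝ} (hab : a ≤ b) (hf : IntegrableOn f (Ioo a b)) :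
    IntegrableOn (fun t => f (b - t)) (Ioo 0 ((b - a) / 2)) := by
  have h := (intervalIntegrable_of_integrableOn_Ioo hf
    (by linarith : a ≤ b - (b - a) / 2) (by linarith) le_rfl).comp_sub_left b
  rw [sub_self, sub_sub_cancel] at h
  exact (intervalIntegrable_iff_integrableOn_Ioo_of_le (by linarith)).1 h.symm

lemma integral_comp_sub_half (hg : IntegrableOn g (Ioo a b)) (h0 : ∫ t in a..b, g t = 0)
    {x : ℝ} (hx : x ∈ Icc 0 (b - a)) :
    ∫ t in (0 : ℝ)..x, g (b - t) = -∫ t in a..b - x, g t := by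
  rw [intervalIntegral.integral_comp_sub_left (fun x => g x) b, sub_zero, eq_neg_iff_add_eq_zero,
    add_comm, ← h0]
  have h1 := hx.1
  have h2 := hx.2
  exact intervalIntegral.integral_add_adjacent_intervals
    (intervalIntegrable_of_integrableOn_Ioo hg le_rfl (by linarith) (by linarith))
    (intervalIntegrable_of_integrableOn_Ioo hg (by linarith) (by linarith) le_rfl)

lemma integral_comp_add_half (x : ℝ) :
    ∫ t in (0 : ℝ)..x, g (a + t) = ∫ t in a..a + x, g t := by
  rw [intervalIntegral.integral_comp_add_left (fun x => g x) a, add_zero]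

lemma continuousOn_primitive_Icc (hg : IntegrableOn g (Ioo a b)) :
    ContinuousOn (fun x => ∫ t in a..x, g t) (Icc a b) :=
  (intervalIntegral.continuousOn_primitive
    ((integrableOn_Icc_iff_integrableOn_Ioo).2 hg)).congr fun _ hx =>
      intervalIntegral.integral_of_le hx.1

lemma integral_abs_primitive_rpow_eq_add_halves (hr : 1 < r) (hab : a ≤ b)
    (hg : IntegrableOn g (Ioo a b)) (h0 : ∫ t in a..b, g t = 0) :
    ∫ x in a..b, |∫ t in a..x, g t| ^ r
      = (∫ x in (0 : ℝ)..(b - a) / 2, |∫ t in (0 : ℝ)..x, g (a + t)| ^ r)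
        + ∫ x in (0 : ℝ)..(b - a) / 2, |∫ t in (0 : ℝ)..x, g (b - t)| ^ r := by
  have hc : ContinuousOn (fun x => |∫ t in a..x, g t| ^ r) (Icc a b) :=
    (continuousOn_primitive_Icc hg).abs.rpow_const fun _ _ => Or.inr (by linarith)
  rw [integral_eq_add_halves hab (hc.integrableOn_Icc.mono_set Ioo_subset_Icc_self)]
  congr 1
  · exact intervalIntegral.integral_congr fun x _ => by
      simp only [integral_comp_add_half]
  · refine intervalIntegral.integral_congr fun x hx => ?_
    rw [uIcc_of_le (by linarith)] at hx
    rw [integral_comp_sub_half hg h0 ⟨hx.1, by linarith [hx.2]⟩, abs_neg]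

/-- The Poincaré inequality with its best constant on a bounded interval. -/
theorem dirichlet_inequality (hr : 1 < r) (hab : a < b) (hg : IntegrableOn g (Ioo a b))
    (hgr : IntegrableOn (fun t => |g t| ^ r) (Ioo a b)) (h0 : ∫ t in a..b, g t = 0) :
    quarterEigenvalue r ((b - a) / 2) * ∫ x in a..b, |∫ t in a..x, g t| ^ r
      ≤ ∫ t in a..b, |g t| ^ r := by
  have hl : 0 < (b - a) / 2 := by linarith
  rw [integral_abs_primitive_rpow_eq_add_halves hr hab.le hg h0,
    integral_eq_add_halves hab.le hgr, mul_add]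
  exact add_le_add
    (quarterEigenvalue_mul_le hr hl (integrableOn_comp_add_half hab.le hg)
      (integrableOn_comp_add_half hab.le hgr))
    (quarterEigenvalue_mul_le hr hl (integrableOn_comp_sub_half hab.le hg)
      (integrableOn_comp_sub_half hab.le hgr))

theorem dirichlet_equality (hr : 1 < r) (hab : a < b) (hg : IntegrableOn g (Ioo a b))
    (hgr : IntegrableOn (fun t => |g t| ^ r) (Ioo a b)) (h0 : ∫ t in a..b, g t = 0)
    (heq : quarterEigenvalue r ((b - a) / 2) * ∫ x in a..b, |∫ t in a..x, g t| ^ r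
      = ∫ t in a..b, |g t| ^ r) :
    ∃ c, (∀ᵐ t ∂(volume.restrict (Ioo 0 ((b - a) / 2))),
        g (a + t) = c * quarterCos r ((b - a) / 2) t) ∧
      ∀ᵐ t ∂(volume.restrict (Ioo 0 ((b - a) / 2))),
        g (b - t) = -c * quarterCos r ((b - a) / 2) t := by
  have hl : 0 < (b - a) / 2 := by linarith
  rw [integral_abs_primitive_rpow_eq_add_halves hr hab.le hg h0,
    integral_eq_add_halves hab.le hgr, mul_add] at heq
  have i1 := integrableOn_comp_add_half hab.le hg
  have i2 := integrableOn_comp_add_half hab.le hgr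
  have i3 := integrableOn_comp_sub_half hab.le hg
  have i4 := integrableOn_comp_sub_half hab.le hgr
  have h1 := quarterEigenvalue_mul_le hr hl i1 i2
  have h2 := quarterEigenvalue_mul_le hr hl i3 i4
  obtain ⟨c, hc⟩ := ae_eq_of_quarterEigenvalue_mul_eq hr hl i1 i2 (by linarith)
  obtain ⟨d, hd⟩ := ae_eq_of_quarterEigenvalue_mul_eq hr hl i3 i4 (by linarith)
  -- Both half problems reach the same value at the midpoint; the zero total integral turns this
  -- into opposite factors.
  have hcd : d = -c := by
    have h3 := eq_of_ae_eq_mul_quarterCos hr hl (right_mem_Icc.2 hl.le) hc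
    have h4 := eq_of_ae_eq_mul_quarterCos hr hl (right_mem_Icc.2 hl.le) hd
    rw [quarterSin_self hr hl, mul_one] at h3 h4
    rw [← h3, ← h4, integral_comp_sub_half hg h0 ⟨hl.le, by linarith⟩, integral_comp_add_half]
    congr 3
    ring
  exact ⟨c, hc, hcd ▸ hd⟩

end Dirichlet

/-! ### The full wave on (0, T). -/

/-- The positive first eigenfunction of the `r`-Laplacian on `(0, T)` with maximum `1`. -/
noncomputable def waveSin (r T x : ℝ) : ℝ := quarterSin r (T / 2) (min x (T - x))

/-- The derivative of `waveSin`. -/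
noncomputable def waveCos (r T x : ℝ) : ℝ :=
  if x < T / 2 then quarterCos r (T / 2) x else -quarterCos r (T / 2) (T - x)

section Wave

variable {r T : ℝ}

lemma waveSin_of_le {x : ℝ} (hx : x ≤ T / 2) : waveSin r T x = quarterSin r (T / 2) x := by
  rw [waveSin, min_eq_left (by linarith)]

lemma waveSin_sub (x : ℝ) : waveSin r T (T - x) = waveSin r T x := by
  rw [waveSin, waveSin, sub_sub_cancel, min_comm]

lemma waveCos_of_lt {x : ℝ} (hx : x < T / 2) : waveCos r T x = quarterCos r (T / 2) x := by
  rw [waveCos, if_pos hx]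

lemma waveCos_sub {x : ℝ} (hx : x < T / 2) : waveCos r T (T - x) = -quarterCos r (T / 2) x := by
  rw [waveCos, if_neg (by linarith), sub_sub_cancel]

lemma continuous_waveSin (hr : 1 < r) : Continuous (waveSin r T) :=
  (continuous_quarterSin hr).comp (continuous_id.min (continuous_const.sub continuous_id))

lemma measurable_waveCos (hr : 1 < r) : Measurable (waveCos r T) :=
  Measurable.ite measurableSet_Iio (continuous_quarterCos hr).measurable
    ((continuous_quarterCos hr).measurable.comp (measurable_const.sub measurable_id)).neg

lemma abs_waveCos_le (hr : 1 < r) (hT : 0 < T) {x : ℝ} (hx : x ∈ Ioo 0 T) :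
    |waveCos r T x| ≤ quarterPeriod r / (T / 2) := by
  have hl : 0 < T / 2 := by linarith
  rw [waveCos]
  split_ifs with h
  · have hm : x ∈ Icc 0 (T / 2) := ⟨hx.1.le, h.le⟩
    rw [abs_of_nonneg (quarterCos_nonneg hr hl hm)]
    exact quarterCos_le hr hl hm
  · have hm : T - x ∈ Icc 0 (T / 2) := ⟨by linarith [hx.2], by linarith⟩
    rw [abs_neg, abs_of_nonneg (quarterCos_nonneg hr hl hm)]
    exact quarterCos_le hr hl hm

lemma integrableOn_waveCos (hr : 1 < r) (hT : 0 < T) : IntegrableOn (waveCos r T) (Ioo 0 T) :=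
  Measure.integrableOn_of_bounded (M := quarterPeriod r / (T / 2)) (by simp)
    (measurable_waveCos hr).aestronglyMeasurable
    ((ae_restrict_iff' measurableSet_Ioo).2 (ae_of_all _ fun _ hx => abs_waveCos_le hr hT hx))

lemma setIntegral_congr_interval {f g : ℝ → ℝ} {a b : ℝ} (hab : a ≤ b)
    (h : ∀ x ∈ Ioo a b, f x = g x) : ∫ x in a..b, f x = ∫ x in a..b, g x := by
  rw [intervalIntegral.integral_of_le hab, intervalIntegral.integral_of_le hab,
    integral_Ioc_eq_integral_Ioo, integral_Ioc_eq_integral_Ioo]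
  exact setIntegral_congr_fun measurableSet_Ioo h

lemma integral_waveCos_of_le (hr : 1 < r) (hT : 0 < T) {x : ℝ} (hx : x ∈ Icc 0 (T / 2)) :
    ∫ t in (0 : ℝ)..x, waveCos r T t = quarterSin r (T / 2) x := by
  rw [← integral_quarterCos hr (half_pos hT) hx]
  exact setIntegral_congr_interval hx.1 fun t ht => waveCos_of_lt (ht.2.trans_le hx.2)

lemma integral_waveCos_eq_zero (hr : 1 < r) (hT : 0 < T) :
    ∫ t in (0 : ℝ)..T, waveCos r T t = 0 := by
  rw [integral_eq_add_halves hT.le (integrableOn_waveCos hr hT), sub_zero]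
  simp only [zero_add]
  rw [setIntegral_congr_interval (half_pos hT).le fun t ht => waveCos_of_lt ht.2,
    setIntegral_congr_interval (half_pos hT).le fun t ht => waveCos_sub ht.2,
    intervalIntegral.integral_neg]
  ring

lemma integral_waveCos (hr : 1 < r) (hT : 0 < T) {x : ℝ} (hx : x ∈ Icc 0 T) :
    ∫ t in (0 : ℝ)..x, waveCos r T t = waveSin r T x := by
  rcases le_total x (T / 2) with h | h
  · rw [integral_waveCos_of_le hr hT ⟨hx.1, h⟩, waveSin_of_le h]
  · have hm : T - x ∈ Icc 0 (T / 2) := ⟨by linarith [hx.2], by linarith⟩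
    have h1 := integral_comp_sub_half (integrableOn_waveCos hr hT) (integral_waveCos_eq_zero hr hT)
      (x := T - x) ⟨hm.1, by linarith [hx.1]⟩
    rw [sub_sub_cancel] at h1
    rw [← neg_eq_iff_eq_neg.2 h1, ← waveSin_sub, waveSin_of_le hm.2,
      ← integral_quarterCos hr (half_pos hT) hm,
      setIntegral_congr_interval hm.1 fun t ht => waveCos_sub (ht.2.trans_le hm.2),
      intervalIntegral.integral_neg, neg_neg]

end Wave

/-! ### `MemSobolevZero` as primitives of mean-zero functions in L^r. -/

section Sobolev

variable {r T : ℝ}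

instance (T : ℝ) : IsFiniteMeasure (intervalMeasure T) := by
  unfold intervalMeasure; infer_instance

lemma one_le_ofReal (hr : 1 < r) : (1 : ENNReal) ≤ ENNReal.ofReal r := by
  rw [← ENNReal.ofReal_one]; exact ENNReal.ofReal_le_ofReal hr.le

lemma memLp_integrableOn (hr : 1 < r) {f : ℝ → ℝ}
    (hf : MemLp f (ENNReal.ofReal r) (intervalMeasure T)) : IntegrableOn f (Ioo 0 T) :=
  hf.integrable (one_le_ofReal hr)

lemma memLp_integrableOn_rpow (hr : 1 < r) {f : ℝ → ℝ}
    (hf : MemLp f (ENNReal.ofReal r) (intervalMeasure T)) :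
    IntegrableOn (fun x => |f x| ^ r) (Ioo 0 T) := by
  have h := hf.integrable_norm_rpow (by positivity) ENNReal.ofReal_ne_top
  rw [ENNReal.toReal_ofReal (by linarith)] at h
  exact h

lemma integral_intervalMeasure (hT : 0 < T) (f : ℝ → ℝ) :
    ∫ x, f x ∂(intervalMeasure T) = ∫ x in (0 : ℝ)..T, f x := by
  rw [intervalMeasure, intervalIntegral.integral_of_le hT.le, integral_Ioc_eq_integral_Ioo]

lemma normPow_eq (hT : 0 < T) (f : ℝ → ℝ) :
    normPow T r f = ∫ x in (0 : ℝ)..T, |f x| ^ r := integral_intervalMeasure hT _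

lemma tendsto_integral_abs {ι : Type*} {F : Filter ι} (hr : 1 < r) {f : ι → ℝ → ℝ}
    (hf : ∀ i, MemLp (f i) (ENNReal.ofReal r) (intervalMeasure T))
    (h : Tendsto (fun i => eLpNorm (f i) (ENNReal.ofReal r) (intervalMeasure T)) F (𝓝 0)) :
    Tendsto (fun i => ∫ x, |f i x| ∂(intervalMeasure T)) F (𝓝 0) := by
  have h1 : ∀ i, ∫ x, |f i x| ∂(intervalMeasure T)
      = (eLpNorm (f i) 1 (intervalMeasure T)).toReal := fun i => by
    rw [eLpNorm_one_eq_lintegral_enorm,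
      ← integral_norm_eq_lintegral_enorm (hf i).aestronglyMeasurable]
    rfl
  simp only [h1]
  rw [← ENNReal.toReal_zero]
  refine (ENNReal.tendsto_toReal ENNReal.zero_ne_top).comp ?_
  have h2 : Tendsto (fun i => eLpNorm (f i) (ENNReal.ofReal r) (intervalMeasure T) *
      intervalMeasure T univ ^ (1 / (1 : ENNReal).toReal - 1 / (ENNReal.ofReal r).toReal)) F
      (𝓝 0) := by
    have := ENNReal.Tendsto.mul_const (b := intervalMeasure T univ ^
      (1 / (1 : ENNReal).toReal - 1 / (ENNReal.ofReal r).toReal)) h (Or.inr ?_)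
    · rwa [zero_mul] at this
    · refine (ENNReal.rpow_lt_top_of_nonneg ?_ (measure_ne_top _ _)).ne
      rw [ENNReal.toReal_one, ENNReal.toReal_ofReal (by linarith), div_one, sub_nonneg,
        div_le_one (by linarith)]
      exact hr.le
  exact tendsto_of_tendsto_of_tendsto_of_le_of_le tendsto_const_nhds h2 (fun _ => zero_le)
    fun i => eLpNorm_le_eLpNorm_mul_rpow_measure_univ (one_le_ofReal hr) (hf i).aestronglyMeasurable

lemma abs_primitive_le {f : ℝ → ℝ} (hf : IntegrableOn f (Ioo 0 T)) {x : ℝ} (hx : x ∈ Icc 0 T) :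
    |∫ t in (0 : ℝ)..x, f t| ≤ ∫ t, |f t| ∂(intervalMeasure T) := by
  have hT : 0 ≤ T := hx.1.trans hx.2
  refine (intervalIntegral.abs_integral_le_integral_abs hx.1).trans ?_
  rw [intervalIntegral.integral_of_le hx.1, integral_Ioc_eq_integral_Ioo, intervalMeasure]
  exact setIntegral_mono_set hf.abs (ae_of_all _ fun _ => abs_nonneg _)
    (Ioo_subset_Ioo_right hx.2).eventuallyLE

/-- A primitive is bounded uniformly by the L^1 norm, which on a finite measure space is controlled
by the L^r norm. -/
lemma tendsto_eLpNorm_primitive {ι : Type*} {F : Filter ι} (hr : 1 < r) {f : ι → ℝ → ℝ}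
    (hf : ∀ i, MemLp (f i) (ENNReal.ofReal r) (intervalMeasure T))
    (h : Tendsto (fun i => eLpNorm (f i) (ENNReal.ofReal r) (intervalMeasure T)) F (𝓝 0)) :
    Tendsto (fun i => eLpNorm (fun x => ∫ t in (0 : ℝ)..x, f i t) (ENNReal.ofReal r)
      (intervalMeasure T)) F (𝓝 0) := by
  have h1 := ENNReal.tendsto_ofReal (tendsto_integral_abs hr hf h)
  rw [ENNReal.ofReal_zero] at h1
  have h2 := ENNReal.Tendsto.const_mul (a := intervalMeasure T univ ^ (ENNReal.ofReal r).toReal⁻¹)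
    h1 (Or.inr (ENNReal.rpow_lt_top_of_nonneg (by positivity) (measure_ne_top _ _)).ne)
  rw [mul_zero] at h2
  refine tendsto_of_tendsto_of_tendsto_of_le_of_le tendsto_const_nhds h2 (fun _ => zero_le)
    fun i => eLpNorm_le_of_ae_bound ?_
  exact (ae_restrict_iff' measurableSet_Ioo).2 (ae_of_all _ fun x hx =>
    abs_primitive_le (memLp_integrableOn hr (hf i)) (Ioo_subset_Icc_self hx))

lemma IsTestFunction.memLp {φ : ℝ → ℝ} (hφ : IsTestFunction T φ) (p : ENNReal) :
    MemLp φ p (intervalMeasure T) ∧ MemLp (deriv φ) p (intervalMeasure T) := by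
  have : IsFiniteMeasureOnCompacts (intervalMeasure T) := ⟨fun _ _ => measure_lt_top _ _⟩
  exact ⟨hφ.1.continuous.memLp_of_hasCompactSupport hφ.2.1,
    (hφ.1.continuous_deriv (by simp)).memLp_of_hasCompactSupport hφ.2.1.deriv⟩

lemma IsTestFunction.eq_zero {φ : ℝ → ℝ} (hφ : IsTestFunction T φ) {x : ℝ} (hx : x ∉ Ioo 0 T) :
    φ x = 0 := image_eq_zero_of_notMem_tsupport fun h => hx (hφ.2.2 h)

lemma IsTestFunction.integral_deriv {φ : ℝ → ℝ} (hφ : IsTestFunction T φ) (x : ℝ) :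
    ∫ t in (0 : ℝ)..x, deriv φ t = φ x := by
  rw [intervalIntegral.integral_deriv_eq_sub
    (fun y _ => (hφ.1.differentiable (by simp)).differentiableAt)
    ((hφ.1.continuous_deriv (by simp)).intervalIntegrable _ _), hφ.eq_zero (x := 0) (by simp),
    sub_zero]

lemma IsTestFunction.memSobolevZero {φ : ℝ → ℝ} (hφ : IsTestFunction T φ) :
    MemSobolevZero T r φ (deriv φ) :=
  ⟨(hφ.memLp _).1, (hφ.memLp _).2, fun _ => φ, fun _ => hφ, by simp, by simp⟩

theorem MemSobolevZero.integral_eq_zero (hr : 1 < r) (hT : 0 < T) {u du : ℝ → ℝ}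
    (h : MemSobolevZero T r u du) : ∫ t in (0 : ℝ)..T, du t = 0 := by
  obtain ⟨-, hdu, φ, hφ, -, hlim⟩ := h
  have hm : ∀ n, MemLp (deriv (φ n) - du) (ENNReal.ofReal r) (intervalMeasure T) :=
    fun n => ((hφ n).memLp _).2.sub hdu
  have h1 := tendsto_integral_abs hr hm hlim
  have h2 : ∀ n, |∫ t in (0 : ℝ)..T, du t| ≤ ∫ x, |(deriv (φ n) - du) x| ∂(intervalMeasure T) := by
    intro n
    have h3 := abs_primitive_le (memLp_integrableOn hr (hm n)) (right_mem_Icc.2 hT.le)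
    refine le_trans (le_of_eq ?_) h3
    simp only [Pi.sub_apply]
    rw [intervalIntegral.integral_sub
      (((hφ n).1.continuous_deriv (by simp)).intervalIntegrable _ _)
      (intervalIntegrable_of_integrableOn_Ioo (memLp_integrableOn hr hdu) le_rfl hT.le le_rfl),
      (hφ n).integral_deriv, (hφ n).eq_zero (by simp), zero_sub, abs_neg]
  have h4 := ge_of_tendsto' h1 h2
  exact abs_eq_zero.1 (le_antisymm h4 (abs_nonneg _))

theorem MemSobolevZero.ae_eq_primitive (hr : 1 < r) {u du : ℝ → ℝ}
    (h : MemSobolevZero T r u du) :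
    u =ᵐ[intervalMeasure T] fun x => ∫ t in (0 : ℝ)..x, du t := by
  obtain ⟨hu, hdu, φ, hφ, hlim0, hlim⟩ := h
  have hm : ∀ n, MemLp (deriv (φ n) - du) (ENNReal.ofReal r) (intervalMeasure T) :=
    fun n => ((hφ n).memLp _).2.sub hdu
  have h1 := (tendsto_eLpNorm_primitive hr hm hlim).add hlim0
  rw [add_zero] at h1
  have hdi := memLp_integrableOn hr hdu
  set U : ℝ → ℝ := fun x => ∫ t in (0 : ℝ)..x, du t with hU
  have hprim : ∀ f : ℝ → ℝ, IntegrableOn f (Ioo 0 T) →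
      AEStronglyMeasurable (fun x => ∫ t in (0 : ℝ)..x, f t) (intervalMeasure T) := fun f hf =>
    ((continuousOn_primitive_of_integrableOn hf).mono Ioo_subset_Icc_self).aestronglyMeasurable
      measurableSet_Ioo
  have h2 : ∀ n, eLpNorm (u - U) (ENNReal.ofReal r) (intervalMeasure T)
      ≤ eLpNorm (fun x => ∫ t in (0 : ℝ)..x, (deriv (φ n) - du) t) (ENNReal.ofReal r)
        (intervalMeasure T) + eLpNorm (φ n - u) (ENNReal.ofReal r) (intervalMeasure T) := by
    intro n
    have h3 : (u - U) =ᵐ[intervalMeasure T]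
        (fun x => ∫ t in (0 : ℝ)..x, (deriv (φ n) - du) t) - (φ n - u) := by
      refine (ae_restrict_iff' measurableSet_Ioo).2 (ae_of_all _ fun x hx => ?_)
      simp only [Pi.sub_apply]
      rw [intervalIntegral.integral_sub
        (((hφ n).1.continuous_deriv (by simp)).intervalIntegrable _ _)
        (intervalIntegrable_of_integrableOn_Ioo hdi le_rfl hx.1.le hx.2.le),
        (hφ n).integral_deriv, hU]
      ring
    rw [eLpNorm_congr_ae h3]
    exact eLpNorm_sub_le (hprim _ (memLp_integrableOn hr (hm n)))
      (((hφ n).memLp _).1.sub hu).aestronglyMeasurable (one_le_ofReal hr)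
  have h4 : eLpNorm (u - U) (ENNReal.ofReal r) (intervalMeasure T) = 0 :=
    le_antisymm (ge_of_tendsto' h1 h2) zero_le
  rw [eLpNorm_eq_zero_iff (hu.aestronglyMeasurable.sub (hprim _ hdi))
    (by have := one_le_ofReal hr; positivity)] at h4
  filter_upwards [h4] with x hx
  simpa [sub_eq_zero] using hx

/-- A smooth approximation f of g is multiplied by a cutoff χ equal to 1 off a thin boundary layer;
the error is at most |g - f| plus |g| on the layer, small by absolute continuity. -/
lemma exists_smooth_approx (hr : 1 < r) (hT : 0 < T) {g : ℝ → ℝ}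
    (hg : MemLp g (ENNReal.ofReal r) (intervalMeasure T)) {ε : ℝ} (hε : 0 < ε) :
    ∃ ψ, IsTestFunction T ψ ∧
      eLpNorm (ψ - g) (ENNReal.ofReal r) (intervalMeasure T) ≤ ENNReal.ofReal ε := by
  have : IsFiniteMeasureOnCompacts (intervalMeasure T) := ⟨fun _ _ => measure_lt_top _ _⟩
  obtain ⟨f, hfc, hfs, hfg⟩ := hg.exist_eLpNorm_sub_le ENNReal.ofReal_ne_top (one_le_ofReal hr)
    (half_pos hε)
  obtain ⟨δ, hδ, hind⟩ := hg.eLpNorm_indicator_le (one_le_ofReal hr) ENNReal.ofReal_ne_top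
    (half_pos hε)
  -- Two layers of width d have total measure at most δ, and d ≤ T / 4 keeps the cutoff radii
  -- positive.
  set d := min (δ / 2) (T / 4) with hd
  have hd0 : 0 < d := by positivity
  have hd1 : d ≤ δ / 2 := min_le_left _ _
  have hd2 : d ≤ T / 4 := min_le_right _ _
  let χ : ContDiffBump (T / 2) := ⟨T / 2 - d, T / 2 - d / 2, by linarith, by linarith⟩
  have hout : χ.rOut = T / 2 - d / 2 := rfl
  have hin : χ.rIn = T / 2 - d := rfl
  set s : Set ℝ := (Icc d (T - d))ᶜ with hs
  have hμs : intervalMeasure T s ≤ ENNReal.ofReal δ := by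
    rw [intervalMeasure, Measure.restrict_apply measurableSet_Icc.compl]
    have : s ∩ Ioo 0 T ⊆ Ioo 0 d ∪ Ioo (T - d) T := by
      rintro x ⟨hx, hx2⟩
      rw [hs, mem_compl_iff, mem_Icc, not_and_or, not_le, not_le] at hx
      exact hx.imp (fun h => ⟨hx2.1, h⟩) fun h => ⟨h, hx2.2⟩
    refine (measure_mono this).trans ((measure_union_le _ _).trans ?_)
    rw [Real.volume_Ioo, Real.volume_Ioo, ← ENNReal.ofReal_add (by linarith) (by linarith)]
    exact ENNReal.ofReal_le_ofReal (by linarith)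
  refine ⟨fun x => χ x * f x, ⟨χ.contDiff.mul hfs, hfc.mul_left, ?_⟩, ?_⟩
  · refine (closure_mono (Function.support_mul_subset_left _ _)).trans ?_
    have h := χ.tsupport_eq
    rw [tsupport] at h
    rw [h, hout, Real.closedBall_eq_Icc]
    intro x hx
    exact ⟨by linarith [hx.1], by linarith [hx.2]⟩
  · have h1 : eLpNorm ((fun x => χ x * f x) - g) (ENNReal.ofReal r) (intervalMeasure T)
        ≤ eLpNorm (fun x => ‖(g - f) x‖ + ‖s.indicator g x‖) (ENNReal.ofReal r)
          (intervalMeasure T) := by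
      refine eLpNorm_mono_real fun x => ?_
      have hχ0 : 0 ≤ χ x := χ.nonneg
      have hχ1 : χ x ≤ 1 := χ.le_one
      by_cases hx : x ∈ s
      · rw [indicator_of_mem hx]
        have : ((fun x => χ x * f x) - g) x = -(χ x * (g - f) x) - (1 - χ x) * g x := by
          simp only [Pi.sub_apply]; ring
        rw [this]
        refine (norm_sub_le _ _).trans (add_le_add ?_ ?_)
        · rw [norm_neg, norm_mul, Real.norm_of_nonneg hχ0]
          exact mul_le_of_le_one_left (norm_nonneg _) hχ1
        · rw [norm_mul, Real.norm_of_nonneg (by linarith)]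
          exact mul_le_of_le_one_left (norm_nonneg _) (by linarith)
      · have hx' : χ x = 1 := by
          apply χ.one_of_mem_closedBall
          rw [hs, notMem_compl_iff] at hx
          rw [hin, Real.closedBall_eq_Icc]
          exact ⟨by linarith [hx.1], by linarith [hx.2]⟩
        simp only [Pi.sub_apply, hx', one_mul]
        rw [norm_sub_rev]
        exact le_add_of_nonneg_right (norm_nonneg _)
    have hgm := hg.aestronglyMeasurable
    refine h1.trans ((eLpNorm_add_le (hgm.sub hfs.continuous.aestronglyMeasurable).norm
      (hgm.indicator measurableSet_Icc.compl).norm (one_le_ofReal hr)).trans ?_)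
    rw [eLpNorm_norm, eLpNorm_norm]
    refine (add_le_add hfg (hind s measurableSet_Icc.compl hμs)).trans ?_
    rw [← ENNReal.ofReal_add (by positivity) (by positivity), add_halves]

/-- The zero mean is what makes the primitive vanish again to the right of the support. -/
lemma IsTestFunction.primitive {ψ : ℝ → ℝ} (hψ : IsTestFunction T ψ)
    (h0 : ∫ t in (0 : ℝ)..T, ψ t = 0) :
    IsTestFunction T (fun x => ∫ t in (0 : ℝ)..x, ψ t) ∧
      deriv (fun x => ∫ t in (0 : ℝ)..x, ψ t) = ψ := by
  have hc := hψ.1.continuous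
  have hd : deriv (fun x => ∫ t in (0 : ℝ)..x, ψ t) = ψ := by
    ext x
    exact (hc.integral_hasStrictDerivAt 0 x).hasDerivAt.deriv
  refine ⟨?_, hd⟩
  have hsmooth : ContDiff ℝ ∞ fun x => ∫ t in (0 : ℝ)..x, ψ t := by
    rw [contDiff_infty_iff_deriv, hd]
    exact ⟨fun x => (hc.integral_hasStrictDerivAt 0 x).hasDerivAt.differentiableAt, hψ.1⟩
  rcases (tsupport ψ).eq_empty_or_nonempty with he | hne
  · have : ψ = 0 := tsupport_eq_empty_iff.1 he
    subst this
    simp only [Pi.zero_apply, intervalIntegral.integral_zero]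
    exact ⟨contDiff_const, HasCompactSupport.zero, by simp [tsupport]⟩
  have hK : IsCompact (tsupport ψ) := hψ.2.1
  obtain ⟨a, haK, ha⟩ := hK.exists_isLeast hne
  obtain ⟨b, hbK, hb⟩ := hK.exists_isGreatest hne
  have hzero : ∀ x, x ∉ Icc a b → ψ x = 0 := fun x hx =>
    image_eq_zero_of_notMem_tsupport fun h => hx ⟨ha h, hb h⟩
  have hsupp : Function.support (fun x => ∫ t in (0 : ℝ)..x, ψ t) ⊆ Icc a b := by
    intro x hx
    by_contra hxn
    apply hx
    rw [mem_Icc, not_and_or, not_le, not_le] at hxn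
    simp only
    rcases hxn with h | h
    · rw [intervalIntegral.integral_congr (g := fun _ => 0), intervalIntegral.integral_zero]
      intro t ht
      refine hzero t fun ht2 => ?_
      have h3 : t ≤ max 0 x := ht.2
      have h4 : max 0 x < a := max_lt (hψ.2.2 haK).1 h
      linarith [ht2.1]
    · have h5 : ∫ t in x..T, ψ t = 0 := by
        rw [intervalIntegral.integral_congr (g := fun _ => 0), intervalIntegral.integral_zero]
        intro t ht
        refine hzero t fun ht2 => ?_
        have h3 : min x T ≤ t := ht.1
        have h4 : b < min x T := lt_min h (hψ.2.2 hbK).2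
        linarith [ht2.2]
      rw [← intervalIntegral.integral_add_adjacent_intervals (hc.intervalIntegrable 0 x)
        (hc.intervalIntegrable x T), h5, add_zero] at h0
      exact h0
  have hts := closure_minimal hsupp isClosed_Icc
  exact ⟨hsmooth, HasCompactSupport.of_support_subset_isCompact isCompact_Icc hsupp,
    hts.trans fun x hx => ⟨(hψ.2.2 haK).1.trans_le hx.1, hx.2.trans_lt (hψ.2.2 hbK).2⟩⟩

lemma exists_isTestFunction_subset {a b : ℝ} (hab : a < b) (ha : 0 ≤ a) (hb : b ≤ T) :
    ∃ η, IsTestFunction T η ∧ tsupport η ⊆ Ioo a b ∧ (∀ x, 0 ≤ η x) ∧ η ((a + b) / 2) = 1 := by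
  let χ : ContDiffBump ((a + b) / 2) := ⟨(b - a) / 8, (b - a) / 4, by linarith, by linarith⟩
  have hout : χ.rOut = (b - a) / 4 := rfl
  have hts : tsupport χ ⊆ Ioo a b := by
    rw [χ.tsupport_eq, hout, Real.closedBall_eq_Icc]
    intro x hx
    exact ⟨by linarith [hx.1], by linarith [hx.2]⟩
  exact ⟨χ, ⟨χ.contDiff, χ.hasCompactSupport, hts.trans (Ioo_subset_Ioo ha hb)⟩, hts,
    fun x => χ.nonneg, χ.one_of_mem_closedBall (by simp [χ.rIn_pos.le])⟩

theorem memSobolevZero_primitive (hr : 1 < r) (hT : 0 < T) {g : ℝ → ℝ}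
    (hg : MemLp g (ENNReal.ofReal r) (intervalMeasure T)) (h0 : ∫ t in (0 : ℝ)..T, g t = 0) :
    MemSobolevZero T r (fun x => ∫ t in (0 : ℝ)..x, g t) g := by
  have hgi := memLp_integrableOn hr hg
  obtain ⟨η₀, hη₀, -, hη0, hη1⟩ := exists_isTestFunction_subset hT le_rfl (le_refl T)
  have hI : 0 < ∫ t in (0 : ℝ)..T, η₀ t := by
    refine intervalIntegral.integral_pos hT hη₀.1.continuous.continuousOn (fun x _ => hη0 x)
      ⟨(0 + T) / 2, ⟨by linarith, by linarith⟩, by rw [hη1]; exact one_pos⟩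
  choose ψ hψ hψg using fun n : ℕ => exists_smooth_approx hr hT hg
    (Nat.one_div_pos_of_nat (n := n) : (0 : ℝ) < 1 / (n + 1))
  -- Subtracting `m n • η₀` restores mean zero, so the primitives are test functions; the correction
  -- tends to zero since g has mean zero.
  set m : ℕ → ℝ := fun n => (∫ t in (0 : ℝ)..T, ψ n t) / ∫ t in (0 : ℝ)..T, η₀ t with hm
  set θ : ℕ → ℝ → ℝ := fun n => ψ n - m n • η₀ with hθ
  have hθt : ∀ n, IsTestFunction T (θ n) := fun n => by
    refine ⟨(hψ n).1.sub (show ContDiff ℝ ∞ (m n • η₀) from hη₀.1.const_smul (m n)),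
      (hψ n).2.1.sub (hη₀.2.1.smul_left), ?_⟩
    refine (tsupport_sub _ _).trans (union_subset (hψ n).2.2 ?_)
    exact (closure_mono (Function.support_const_smul_subset _ _)).trans hη₀.2.2
  have hθ0 : ∀ n, ∫ t in (0 : ℝ)..T, θ n t = 0 := fun n => by
    simp only [hθ, Pi.sub_apply, Pi.smul_apply, smul_eq_mul]
    rw [intervalIntegral.integral_sub ((hψ n).1.continuous.intervalIntegrable _ _)
      ((hη₀.1.continuous.intervalIntegrable _ _).const_mul _), intervalIntegral.integral_const_mul,
      hm]
    field_simp
    ring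
  have hψlim : Tendsto (fun n => eLpNorm (ψ n - g) (ENNReal.ofReal r) (intervalMeasure T)) atTop
      (𝓝 0) := by
    have h1 := ENNReal.tendsto_ofReal (tendsto_one_div_add_atTop_nhds_zero_nat (𝕜 := ℝ))
    rw [ENNReal.ofReal_zero] at h1
    exact tendsto_of_tendsto_of_tendsto_of_le_of_le tendsto_const_nhds h1 (fun _ => zero_le) hψg
  have hψm : ∀ n, MemLp (ψ n - g) (ENNReal.ofReal r) (intervalMeasure T) :=
    fun n => ((hψ n).memLp _).1.sub hg
  have hmlim : Tendsto m atTop (𝓝 0) := by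
    have h1 : Tendsto (fun n => ∫ t in (0 : ℝ)..T, ψ n t) atTop (𝓝 0) := by
      refine squeeze_zero_norm (fun n => ?_) (tendsto_integral_abs hr hψm hψlim)
      have h2 := abs_primitive_le (memLp_integrableOn hr (hψm n)) (right_mem_Icc.2 hT.le)
      refine le_trans (le_of_eq ?_) h2
      simp only [Pi.sub_apply]
      rw [intervalIntegral.integral_sub ((hψ n).1.continuous.intervalIntegrable _ _)
        (intervalIntegrable_of_integrableOn_Ioo hgi le_rfl hT.le le_rfl), h0, sub_zero,
        Real.norm_eq_abs]
    simpa [hm] using h1.div_const (∫ t in (0 : ℝ)..T, η₀ t)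
  have hθlim : Tendsto (fun n => eLpNorm (θ n - g) (ENNReal.ofReal r) (intervalMeasure T)) atTop
      (𝓝 0) := by
    have h1 : Tendsto (fun n => ‖m n‖ₑ * eLpNorm η₀ (ENNReal.ofReal r) (intervalMeasure T)) atTop
        (𝓝 0) := by
      have := ENNReal.Tendsto.mul_const (b := eLpNorm η₀ (ENNReal.ofReal r) (intervalMeasure T))
        hmlim.enorm (Or.inr (hη₀.memLp _).1.eLpNorm_ne_top)
      simpa using this
    have h2 := hψlim.add h1
    rw [add_zero] at h2
    refine tendsto_of_tendsto_of_tendsto_of_le_of_le tendsto_const_nhds h2 (fun _ => zero_le)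
      fun n => ?_
    have h3 : θ n - g = (ψ n - g) - m n • η₀ := by rw [hθ]; ring
    simp only
    rw [h3, ← eLpNorm_const_smul]
    exact eLpNorm_sub_le (hψm n).aestronglyMeasurable
      ((hη₀.memLp (ENNReal.ofReal r)).1.aestronglyMeasurable.const_smul _) (one_le_ofReal hr)
  have hθm : ∀ n, MemLp (θ n - g) (ENNReal.ofReal r) (intervalMeasure T) :=
    fun n => ((hθt n).memLp _).1.sub hg
  refine ⟨?_, hg, fun n x => ∫ t in (0 : ℝ)..x, θ n t, fun n => ((hθt n).primitive (hθ0 n)).1,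
    ?_, ?_⟩
  · refine MemLp.of_bound (((continuousOn_primitive_of_integrableOn hgi).mono
      Ioo_subset_Icc_self).aestronglyMeasurable measurableSet_Ioo)
      (∫ t, |g t| ∂(intervalMeasure T)) ?_
    exact (ae_restrict_iff' measurableSet_Ioo).2 (ae_of_all _ fun x hx =>
      abs_primitive_le hgi (Ioo_subset_Icc_self hx))
  · refine (tendsto_eLpNorm_primitive hr hθm hθlim).congr fun n => eLpNorm_congr_ae ?_
    refine (ae_restrict_iff' measurableSet_Ioo).2 (ae_of_all _ fun x hx => ?_)
    simp only [Pi.sub_apply]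
    exact intervalIntegral.integral_sub ((hθt n).1.continuous.intervalIntegrable _ _)
      (intervalIntegrable_of_integrableOn_Ioo hgi le_rfl hx.1.le hx.2.le)
  · refine hθlim.congr fun n => ?_
    rw [((hθt n).primitive (hθ0 n)).2]

end Sobolev

/-! ### First eigenvalue, its eigenfunctions, and the two bounds for the quotient. -/

section FirstEigenvalue

variable {r s T : ℝ}

lemma MemSobolevZero.congr_ae {u u' du : ℝ → ℝ} (h : MemSobolevZero T r u du)
    (huu' : u =ᵐ[intervalMeasure T] u') : MemSobolevZero T r u' du := by
  obtain ⟨hu, hdu, φ, hφ, h1, h2⟩ := h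
  refine ⟨hu.ae_eq huu', hdu, φ, hφ, h1.congr fun n => eLpNorm_congr_ae ?_, h2⟩
  filter_upwards [huu'] with x hx
  simp [hx]

lemma memLp_waveCos (hr : 1 < r) (hT : 0 < T) (p : ENNReal) :
    MemLp (waveCos r T) p (intervalMeasure T) :=
  MemLp.of_bound (measurable_waveCos hr).aestronglyMeasurable (quarterPeriod r / (T / 2))
    ((ae_restrict_iff' measurableSet_Ioo).2 (ae_of_all _ fun _ hx => abs_waveCos_le hr hT hx))

lemma memSobolevZero_wave (hs : 1 < s) (hr : 1 < r) (hT : 0 < T) :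
    MemSobolevZero T s (waveSin r T) (waveCos r T) := by
  refine (memSobolevZero_primitive hs hT (memLp_waveCos hr hT _)
    (integral_waveCos_eq_zero hr hT)).congr_ae ?_
  exact (ae_restrict_iff' measurableSet_Ioo).2 (ae_of_all _ fun x hx =>
    integral_waveCos hr hT (Ioo_subset_Icc_self hx))

lemma MemSobolevZero.normPow_eq_primitive (hr : 1 < r) (hT : 0 < T) {u du : ℝ → ℝ}
    (h : MemSobolevZero T r u du) :
    normPow T r u = ∫ x in (0 : ℝ)..T, |∫ t in (0 : ℝ)..x, du t| ^ r := by
  rw [← integral_intervalMeasure hT, normPow]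
  refine integral_congr_ae ?_
  filter_upwards [h.ae_eq_primitive hr] with x hx
  rw [hx]

lemma normPow_pos (hr : 1 < r) {u : ℝ → ℝ}
    (hu : MemLp u (ENNReal.ofReal r) (intervalMeasure T)) (h0 : ¬ u =ᵐ[intervalMeasure T] 0) :
    0 < normPow T r u := by
  have hn : 0 ≤ normPow T r u := integral_nonneg fun x => Real.rpow_nonneg (abs_nonneg _) _
  refine hn.lt_of_ne' fun h => h0 ?_
  have h1 := (integral_eq_zero_iff_of_nonneg (fun x => Real.rpow_nonneg (abs_nonneg _) _)
    (memLp_integrableOn_rpow hr hu)).1 h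
  filter_upwards [h1] with x hx
  have := (Real.rpow_eq_zero (abs_nonneg (u x)) (by linarith)).1 hx
  simpa using this

theorem MemSobolevZero.quarterEigenvalue_mul_normPow_le (hr : 1 < r) (hT : 0 < T) {u du : ℝ → ℝ}
    (h : MemSobolevZero T r u du) :
    quarterEigenvalue r (T / 2) * normPow T r u ≤ normPow T r du := by
  rw [h.normPow_eq_primitive hr hT, normPow_eq hT]
  have := dirichlet_inequality hr hT (memLp_integrableOn hr h.2.1)
    (memLp_integrableOn_rpow hr h.2.1) (h.integral_eq_zero hr hT)
  rwa [sub_zero] at this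

theorem MemSobolevZero.ae_eq_wave_of_normPow_eq (hr : 1 < r) (hT : 0 < T) {u du : ℝ → ℝ}
    (h : MemSobolevZero T r u du)
    (heq : quarterEigenvalue r (T / 2) * normPow T r u = normPow T r du) :
    ∃ c, (du =ᵐ[intervalMeasure T] fun x => c * waveCos r T x) ∧
      u =ᵐ[intervalMeasure T] fun x => c * waveSin r T x := by
  rw [h.normPow_eq_primitive hr hT, normPow_eq hT] at heq
  obtain ⟨c, h1, h2⟩ := dirichlet_equality hr hT (memLp_integrableOn hr h.2.1)
    (memLp_integrableOn_rpow hr h.2.1) (h.integral_eq_zero hr hT) (by rwa [sub_zero])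
  rw [sub_zero, ae_restrict_iff' measurableSet_Ioo] at h1 h2
  have h3 := (Measure.measurePreserving_sub_left (volume : Measure ℝ) T).quasiMeasurePreserving.ae h2
  have h4 : ∀ᵐ x ∂(volume : Measure ℝ), x ≠ T / 2 := by simp [ae_iff]
  have hdu : du =ᵐ[intervalMeasure T] fun x => c * waveCos r T x := by
    refine (ae_restrict_iff' measurableSet_Ioo).2 ?_
    filter_upwards [h1, h3, h4] with x hx1 hx2 hx3 hxm
    rcases lt_or_gt_of_ne hx3 with hlt | hgt
    · rw [waveCos_of_lt hlt]
      simpa using hx1 ⟨hxm.1, hlt⟩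
    · have h5 := hx2 ⟨by linarith [hxm.2], by linarith⟩
      rw [sub_sub_cancel] at h5
      rw [h5, waveCos, if_neg (by linarith)]
      ring
  refine ⟨c, hdu, (h.ae_eq_primitive hr).trans ?_⟩
  refine (ae_restrict_iff' measurableSet_Ioo).2 (ae_of_all _ fun x hx => ?_)
  simp only
  rw [← integral_waveCos hr hT (Ioo_subset_Icc_self hx), ← intervalIntegral.integral_const_mul,
    intervalIntegral.integral_of_le hx.1.le, intervalIntegral.integral_of_le hx.1.le,
    integral_Ioc_eq_integral_Ioo, integral_Ioc_eq_integral_Ioo]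
  exact integral_congr_ae
    (ae_restrict_of_ae_restrict_of_subset (Ioo_subset_Ioo_right hx.2.le) hdu)

lemma waveSin_mem_Ioc (hr : 1 < r) {x : ℝ} (hx : x ∈ Ioo 0 T) : waveSin r T x ∈ Ioc (0 : ℝ) 1 := by
  have hT : 0 < T := hx.1.trans hx.2
  have key : ∀ y ∈ Ioc 0 (T / 2), quarterSin r (T / 2) y ∈ Ioc (0 : ℝ) 1 := fun y hy => by
    rcases hy.2.eq_or_lt with h | h
    · rw [h, quarterSin_self hr (half_pos hT)]; simp
    · exact Ioo_subset_Ioc_self (quarterSin_mem_Ioo hr (half_pos hT) ⟨hy.1, h⟩)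
  refine key _ ⟨lt_min hx.1 (by linarith [hx.2]), ?_⟩
  rcases le_total x (T / 2) with h | h
  · exact (min_le_left _ _).trans h
  · exact (min_le_right _ _).trans (by linarith)

lemma normPow_waveSin (hs : 1 < s) (hr : 1 < r) (hT : 0 < T) :
    normPow T s (waveSin r T) = 2 * ∫ x in (0 : ℝ)..T / 2, quarterSin r (T / 2) x ^ s := by
  have hl := half_pos hT
  rw [normPow_eq hT, integral_eq_add_halves hT.le
    (memLp_integrableOn_rpow hs (memSobolevZero_wave hs hr hT).1), sub_zero, two_mul]
  have hnn : ∀ x ∈ Ioo 0 (T / 2), |waveSin r T x| ^ s = quarterSin r (T / 2) x ^ s :=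
    fun x hx => by
      rw [waveSin_of_le hx.2.le, abs_of_nonneg (quarterSin_mem_Ioo hr hl hx).1.le]
  congr 1
  · simp only [zero_add]
    exact setIntegral_congr_interval hl.le hnn
  · simp only [waveSin_sub]
    exact setIntegral_congr_interval hl.le hnn

lemma normPow_waveCos (hs : 1 < s) (hr : 1 < r) (hT : 0 < T) :
    normPow T s (waveCos r T) = 2 * ∫ x in (0 : ℝ)..T / 2, quarterCos r (T / 2) x ^ s := by
  have hl := half_pos hT
  rw [normPow_eq hT, integral_eq_add_halves hT.le
    (memLp_integrableOn_rpow hs (memLp_waveCos hr hT _)), sub_zero, two_mul]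
  congr 1 <;> refine setIntegral_congr_interval hl.le fun x hx => ?_
  · rw [zero_add, waveCos_of_lt hx.2,
      abs_of_pos (quarterCos_pos hr hl (Ioo_subset_Ico_self hx))]
  · rw [waveCos_sub hx.2, abs_neg, abs_of_pos (quarterCos_pos hr hl (Ioo_subset_Ico_self hx))]

lemma le_normPow_waveSin (hs : 1 < s) (hr : 1 < r) (hT : 0 < T) :
    T / (s + 1) ≤ normPow T s (waveSin r T) := by
  have hl := half_pos hT
  have h1 : ∫ x in (0 : ℝ)..T / 2, (x / (T / 2)) ^ s = T / 2 / (s + 1) := by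
    rw [intervalIntegral.integral_comp_div (fun x => x ^ s) hl.ne', zero_div, div_self hl.ne',
      integral_rpow (Or.inl (by linarith)), Real.one_rpow, Real.zero_rpow (by linarith), smul_eq_mul]
    ring
  have h2 : ∫ x in (0 : ℝ)..T / 2, (x / (T / 2)) ^ s
      ≤ ∫ x in (0 : ℝ)..T / 2, quarterSin r (T / 2) x ^ s := by
    refine intervalIntegral.integral_mono_on hl.le ?_ ?_ fun x hx => ?_
    · exact ((continuous_id.div_const _).rpow_const fun _ =>
        Or.inr (by linarith)).intervalIntegrable _ _
    · exact ((continuous_quarterSin hr).rpow_const fun _ =>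
        Or.inr (by linarith)).intervalIntegrable _ _
    · exact Real.rpow_le_rpow (div_nonneg hx.1 hl.le) (div_le_quarterSin hr hl hx) (by linarith)
  rw [normPow_waveSin hs hr hT]
  calc T / (s + 1) = 2 * (T / 2 / (s + 1)) := by ring
    _ ≤ _ := by rw [← h1]; linarith

/-- All but one factor of the cosine is bounded by its maximum; the remaining one integrates to the
amplitude 1 on each half. -/
lemma normPow_waveCos_le (hs : 1 < s) (hr : 1 < r) (hT : 0 < T) :
    normPow T s (waveCos r T) ≤ 2 * (quarterPeriod r / (T / 2)) ^ (s - 1) := by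
  have hl := half_pos hT
  have h2 : ∫ x in (0 : ℝ)..T / 2, quarterCos r (T / 2) x ^ s
      ≤ ∫ x in (0 : ℝ)..T / 2, (quarterPeriod r / (T / 2)) ^ (s - 1) * quarterCos r (T / 2) x := by
    refine intervalIntegral.integral_mono_on hl.le ?_ ?_ fun x hx => ?_
    · exact ((continuous_quarterCos hr).rpow_const fun _ =>
        Or.inr (by linarith)).intervalIntegrable _ _
    · exact (continuous_const.mul (continuous_quarterCos hr)).intervalIntegrable _ _
    · have h0 := quarterCos_nonneg hr hl hx
      calc quarterCos r (T / 2) x ^ s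
          = quarterCos r (T / 2) x ^ (s - 1) * quarterCos r (T / 2) x := by
            rw [← Real.rpow_add_one' h0 (by linarith), sub_add_cancel]
        _ ≤ _ := mul_le_mul_of_nonneg_right
            (Real.rpow_le_rpow h0 (quarterCos_le hr hl hx) (by linarith)) h0
  rw [intervalIntegral.integral_const_mul, integral_quarterCos hr hl (right_mem_Icc.2 hl.le),
    quarterSin_self hr hl, mul_one] at h2
  rw [normPow_waveCos hs hr hT]
  linarith

lemma not_waveSin_ae_eq_zero (hr : 1 < r) (hT : 0 < T) :
    ¬ waveSin r T =ᵐ[intervalMeasure T] 0 := by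
  intro h
  have h1 := le_normPow_waveSin hr hr hT
  have h2 : normPow T r (waveSin r T) = 0 := by
    rw [normPow, integral_congr_ae (g := fun _ => 0), integral_zero]
    filter_upwards [h] with x hx
    rw [hx, Pi.zero_apply, abs_zero, Real.zero_rpow (by linarith)]
  have h3 : 0 < T / (r + 1) := div_pos hT (by linarith)
  linarith

lemma abs_rpow_sub_two_mul_self {x : ℝ} (hx : 0 < x) : |x| ^ (r - 2) * x = x ^ (r - 1) := by
  rw [abs_of_pos hx, ← Real.rpow_add_one hx.ne']
  congr 1
  ring

theorem integral_waveCos_mul_eq (hr : 1 < r) (hT : 0 < T) {v dv : ℝ → ℝ}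
    (hv : MemSobolevZero T r v dv) :
    ∫ x, |waveCos r T x| ^ (r - 2) * waveCos r T x * dv x ∂(intervalMeasure T)
      = quarterEigenvalue r (T / 2) *
        ∫ x, |waveSin r T x| ^ (r - 2) * waveSin r T x * v x ∂(intervalMeasure T) := by
  have hl := half_pos hT
  have hdv := memLp_integrableOn hr hv.2.1
  have h0 := hv.integral_eq_zero hr hT
  have hR : ∫ x, |waveSin r T x| ^ (r - 2) * waveSin r T x * v x ∂(intervalMeasure T)
      = ∫ x in (0 : ℝ)..T, waveSin r T x ^ (r - 1) * ∫ t in (0 : ℝ)..x, dv t := by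
    rw [← integral_intervalMeasure hT]
    refine integral_congr_ae ?_
    filter_upwards [hv.ae_eq_primitive hr, ae_restrict_mem measurableSet_Ioo] with x hx hxm
    rw [hx, abs_rpow_sub_two_mul_self (waveSin_mem_Ioc hr hxm).1]
  have hRI : IntegrableOn (fun x => waveSin r T x ^ (r - 1) * ∫ t in (0 : ℝ)..x, dv t)
      (Ioo 0 T) := by
    refine IntegrableOn.mono_set (ContinuousOn.integrableOn_Icc ?_) Ioo_subset_Icc_self
    exact ((continuous_waveSin hr).rpow_const fun _ => Or.inr (by linarith)).continuousOn.mul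
      (continuousOn_primitive_of_integrableOn hdv)
  have hLI : IntegrableOn (fun x => |waveCos r T x| ^ (r - 2) * waveCos r T x * dv x)
      (Ioo 0 T) := by
    refine Integrable.bdd_mul (c := (quarterPeriod r / (T / 2)) ^ (r - 1)) hdv
      (((measurable_waveCos hr).abs.pow_const _).mul
        (measurable_waveCos hr)).aestronglyMeasurable ?_
    refine (ae_restrict_iff' measurableSet_Ioo).2 (ae_of_all _ fun x hx => ?_)
    rw [norm_mul, Real.norm_of_nonneg (Real.rpow_nonneg (abs_nonneg _) _), Real.norm_eq_abs]
    rcases (abs_nonneg (waveCos r T x)).eq_or_lt with h | h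
    · rw [← h, mul_zero]
      exact Real.rpow_nonneg (quarterPeriod_div_pos hr hl).le _
    · have h2 := abs_rpow_sub_two_mul_self (r := r) h
      rw [abs_abs] at h2
      rw [h2]
      exact Real.rpow_le_rpow h.le (abs_waveCos_le hr hT hx) (by linarith)
  rw [hR, integral_intervalMeasure hT, integral_eq_add_halves hT.le hLI,
    integral_eq_add_halves hT.le hRI, sub_zero, mul_add]
  have i1 := integrableOn_comp_sub_half hT.le hdv
  rw [sub_zero] at i1
  congr 1
  · have h1 := integral_quarterCos_rpow_mul hr hl (hdv.mono_set
      (Ioo_subset_Ioo_right (by linarith : T / 2 ≤ T)))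
    simp only [zero_add]
    rw [setIntegral_congr_interval hl.le fun x hx => by
        rw [waveCos_of_lt hx.2,
          abs_rpow_sub_two_mul_self (quarterCos_pos hr hl (Ioo_subset_Ico_self hx))], h1,
      setIntegral_congr_interval hl.le fun x hx => by rw [← waveSin_of_le hx.2.le]]
  · have h1 := integral_quarterCos_rpow_mul hr hl i1
    have h2 : ∀ x ∈ Ioo 0 (T / 2), |waveCos r T (T - x)| ^ (r - 2) * waveCos r T (T - x)
        * dv (T - x) = -(quarterCos r (T / 2) x ^ (r - 1) * dv (T - x)) := fun x hx => by
      rw [waveCos_sub hx.2, abs_neg, mul_neg,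
        abs_rpow_sub_two_mul_self (quarterCos_pos hr hl (Ioo_subset_Ico_self hx)), neg_mul]
    have h3 : ∀ x ∈ Ioo 0 (T / 2), quarterSin r (T / 2) x ^ (r - 1) *
        ∫ t in (0 : ℝ)..x, dv (T - t)
        = -(waveSin r T (T - x) ^ (r - 1) * ∫ t in (0 : ℝ)..T - x, dv t) := fun x hx => by
      rw [integral_comp_sub_half hdv h0 ⟨hx.1.le, by linarith [hx.2]⟩, waveSin_sub,
        waveSin_of_le hx.2.le, mul_neg]
    rw [setIntegral_congr_interval hl.le h2, intervalIntegral.integral_neg, h1,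
      setIntegral_congr_interval hl.le h3, intervalIntegral.integral_neg]
    ring

lemma quarterEigenvalue_mul_normPow_waveSin (hr : 1 < r) (hT : 0 < T) :
    quarterEigenvalue r (T / 2) * normPow T r (waveSin r T) = normPow T r (waveCos r T) := by
  have hl := half_pos hT
  rw [normPow_waveSin hr hr hT, normPow_waveCos hr hr hT]
  have h := integral_quarterCos_rpow_mul hr hl
    ((continuous_quarterCos (r := r) (l := T / 2) hr).continuousOn.integrableOn_Icc.mono_set
      Ioo_subset_Icc_self)
  have h1 : ∀ y : ℝ, 0 < y → y ^ (r - 1) * y = y ^ r := fun y hy => by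
    rw [← Real.rpow_add_one hy.ne', sub_add_cancel]
  have h2 : ∀ x ∈ Ioo 0 (T / 2), quarterSin r (T / 2) x ^ (r - 1) *
      ∫ t in (0 : ℝ)..x, quarterCos r (T / 2) t = quarterSin r (T / 2) x ^ r := fun x hx => by
    rw [integral_quarterCos hr hl (Ioo_subset_Icc_self hx), h1 _ (quarterSin_mem_Ioo hr hl hx).1]
  rw [setIntegral_congr_interval hl.le h2, setIntegral_congr_interval hl.le fun x hx =>
      h1 _ (quarterCos_pos hr hl (Ioo_subset_Ico_self hx))] at h
  rw [h]
  ring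

theorem firstEigenvalue_eq (hr : 1 < r) (hT : 0 < T) :
    firstEigenvalue T r = quarterEigenvalue r (T / 2) := by
  refine IsLeast.csInf_eq ⟨⟨waveSin r T, waveCos r T, memSobolevZero_wave hr hr hT,
    not_waveSin_ae_eq_zero hr hT, ?_⟩, ?_⟩
  · rw [← quarterEigenvalue_mul_normPow_waveSin hr hT, mul_div_cancel_right₀]
    exact (normPow_pos hr (memSobolevZero_wave hr hr hT).1 (not_waveSin_ae_eq_zero hr hT)).ne'
  · rintro ρ ⟨u, du, hu, hu0, rfl⟩
    rw [le_div_iff₀ (normPow_pos hr hu.1 hu0)]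
    exact hu.quarterEigenvalue_mul_normPow_le hr hT

theorem isEigenfunction_wave (hr : 1 < r) (hT : 0 < T) :
    IsEigenfunction T r (firstEigenvalue T r) (waveSin r T) (waveCos r T) :=
  ⟨memSobolevZero_wave hr hr hT, not_waveSin_ae_eq_zero hr hT, fun v dv hv => by
    rw [firstEigenvalue_eq hr hT, integral_waveCos_mul_eq hr hT hv]⟩

lemma integral_abs_rpow_sub_two_mul (hr : 1 < r) (f : ℝ → ℝ) :
    ∫ x, |f x| ^ (r - 2) * f x * f x ∂(intervalMeasure T) = normPow T r f := by
  refine integral_congr_ae (ae_of_all _ fun x => ?_)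
  simp only
  rcases eq_or_ne (f x) 0 with h | h
  · simp [h, Real.zero_rpow (by linarith : r ≠ 0)]
  · rw [mul_assoc, ← abs_mul_abs_self, ← pow_two, ← Real.rpow_natCast,
      ← Real.rpow_add (abs_pos.2 h)]
    norm_num

/-- Testing the weak equation with u itself gives equality in the Dirichlet inequality. -/
theorem IsEigenfunction.ae_eq_wave (hr : 1 < r) (hT : 0 < T) {u du : ℝ → ℝ}
    (h : IsEigenfunction T r (firstEigenvalue T r) u du) :
    ∃ c ≠ 0, (du =ᵐ[intervalMeasure T] fun x => c * waveCos r T x) ∧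
      u =ᵐ[intervalMeasure T] fun x => c * waveSin r T x := by
  obtain ⟨hu, hu0, hw⟩ := h
  have h1 := hw u du hu
  rw [integral_abs_rpow_sub_two_mul hr, integral_abs_rpow_sub_two_mul hr,
    firstEigenvalue_eq hr hT] at h1
  obtain ⟨c, hc1, hc2⟩ := hu.ae_eq_wave_of_normPow_eq hr hT h1.symm
  refine ⟨c, ?_, hc1, hc2⟩
  rintro rfl
  exact hu0 (hc2.trans (ae_of_all _ fun x => by simp))

lemma normPow_of_ae_eq_const_mul (c : ℝ) {f g : ℝ → ℝ}
    (h : f =ᵐ[intervalMeasure T] fun x => c * g x) :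
    normPow T r f = |c| ^ r * normPow T r g := by
  rw [normPow, normPow, ← integral_const_mul]
  refine integral_congr_ae ?_
  filter_upwards [h] with x hx
  rw [hx, abs_mul, Real.mul_rpow (abs_nonneg _) (abs_nonneg _)]

theorem IsEigenfunction.normPow_div_eq (hr : 1 < r) (hT : 0 < T) {u du : ℝ → ℝ}
    (h : IsEigenfunction T r (firstEigenvalue T r) u du) :
    normPow T s du / normPow T s u
      = normPow T s (waveCos r T) / normPow T s (waveSin r T) := by
  obtain ⟨c, hc, h1, h2⟩ := h.ae_eq_wave hr hT
  rw [normPow_of_ae_eq_const_mul c h1, normPow_of_ae_eq_const_mul c h2,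
    mul_div_mul_left _ _ (Real.rpow_pos_of_pos (abs_pos.2 hc) _).ne']

theorem quarterEigenvalue_mul_normPow_waveSin_lt {p q : ℝ} (hq : 1 < q) (hqp : q < p)
    (hT : 0 < T) :
    quarterEigenvalue q (T / 2) * normPow T q (waveSin p T) < normPow T q (waveCos p T) := by
  have hp := hq.trans hqp
  have hl := half_pos hT
  have hw := memSobolevZero_wave hq hp hT
  refine (hw.quarterEigenvalue_mul_normPow_le hq hT).lt_of_ne fun heq => ?_
  obtain ⟨c, hc, -⟩ := hw.ae_eq_wave_of_normPow_eq hq hT heq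
  have hsin' : ∀ x ∈ Icc 0 (T / 2), quarterSin p (T / 2) x = c * quarterSin q (T / 2) x := by
    intro x hx
    rw [← integral_waveCos_of_le hp hT hx, ← integral_waveCos_of_le hq hT hx,
      ← intervalIntegral.integral_const_mul, intervalIntegral.integral_of_le hx.1,
      intervalIntegral.integral_of_le hx.1, integral_Ioc_eq_integral_Ioo,
      integral_Ioc_eq_integral_Ioo]
    exact integral_congr_ae
      (ae_restrict_of_ae_restrict_of_subset (Ioo_subset_Ioo_right (by linarith [hx.2])) hc)
  have hc1 : c = 1 := by
    have := hsin' (T / 2) (right_mem_Icc.2 hl.le)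
    rw [quarterSin_self hp hl, quarterSin_self hq hl] at this
    linarith
  have hsin : ∀ x ∈ Ioo 0 (T / 2), quarterSin p (T / 2) x = quarterSin q (T / 2) x := by
    intro x hx
    rw [hsin' x (Ioo_subset_Icc_self hx), hc1, one_mul]
  have hcos : EqOn (quarterCos p (T / 2)) (quarterCos q (T / 2)) (Ioo 0 (T / 2)) := by
    intro x hx
    refine (hasDerivAt_quarterSin hp hl hx).unique
      ((hasDerivAt_quarterSin hq hl hx).congr_of_eventuallyEq ?_)
    filter_upwards [isOpen_Ioo.mem_nhds hx] with y hy using hsin y hy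
  -- The slopes at 0 identify the two quarter periods. At an interior point, equal sines and cosines
  -- then contradict the strict monotonicity in r of `(1 - s ^ r) ^ (1 / r)`.
  have hcos0 : quarterCos p (T / 2) 0 = quarterCos q (T / 2) 0 := by
    refine hcos.closure (continuous_quarterCos hp) (continuous_quarterCos hq) ?_
    rw [closure_Ioo hl.ne]
    exact left_mem_Icc.2 hl.le
  have h0 : ∀ r : ℝ, 1 < r → quarterCos r (T / 2) 0 = quarterPeriod r / (T / 2) := fun r hr => by
    simp [quarterCos, gcos, gsin_zero hr, Real.zero_rpow (by linarith : r ≠ 0)]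
  rw [h0 p hp, h0 q hq] at hcos0
  have hx : T / 2 / 2 ∈ Ioo 0 (T / 2) := ⟨half_pos hl, half_lt_self hl⟩
  have h1 := hcos hx
  have h2 := hsin _ hx
  have h3 := quarterSin_mem_Ioo hq hl hx
  have h4 := rpow_inv_lt_of_lt hq hqp h3
  simp only [quarterCos, gcos] at h1
  rw [hcos0] at h1
  have h5 := mul_left_cancel₀ (quarterPeriod_div_pos hq hl).ne' h1
  rw [quarterSin, quarterSin, hcos0] at h2
  rw [quarterSin] at h4
  rw [h2] at h5
  exact h4.ne' h5

theorem normPow_wave_div_lt {p q : ℝ} (hq : 1 < q) (hqp : q < p) (hT : 0 < T) :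
    normPow T q (waveCos p T) / normPow T q (waveSin p T)
      < quarterEigenvalue q (T / 4) := by
  have hp := hq.trans hqp
  have hl := half_pos hT
  set P := quarterPeriod p / (T / 2) with hP
  set Q := quarterPeriod q / (T / 2) with hQ
  have hP0 : 0 < P := quarterPeriod_div_pos hp hl
  have hQ0 : 0 < Q := quarterPeriod_div_pos hq hl
  have hPQ : P ≤ Q := div_le_div_of_nonneg_right (quarterPeriod_anti hq hqp) hl.le
  have hden : 0 < T / (q + 1) := div_pos hT (by linarith)
  have h1 : normPow T q (waveCos p T) / normPow T q (waveSin p T)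
      ≤ 2 * P ^ (q - 1) / (T / (q + 1)) :=
    div_le_div₀ (by positivity) (normPow_waveCos_le hq hp hT) hden (le_normPow_waveSin hq hp hT)
  have h2 : 2 * P ^ (q - 1) / (T / (q + 1)) ≤ (1 + q) * (Q ^ (q - 1) * (2 / T)) := by
    calc _ = (1 + q) * (P ^ (q - 1) * (2 / T)) := by field_simp; ring
      _ ≤ _ := by
        have := Real.rpow_le_rpow hP0.le hPQ (by linarith : 0 ≤ q - 1)
        gcongr
  have h3 : 1 + q < 2 ^ q := by
    have := one_add_mul_self_lt_rpow_one_add (s := 1) (by norm_num) one_ne_zero hq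
    norm_num at this
    exact this
  have h4 : 2 / T ≤ (q - 1) * Q := by
    have := one_le_sub_one_mul_quarterPeriod hq
    rw [hQ, ← mul_div_assoc, le_div_iff₀ hl]
    calc 2 / T * (T / 2) = 1 := by field_simp
      _ ≤ _ := this
  -- Halving the length multiplies the eigenvalue by `2 ^ q`, which leaves room for the factor `1 +
  -- q` of the crude estimate.
  have h5 : quarterEigenvalue q (T / 4) = 2 ^ q * (Q ^ (q - 1) * ((q - 1) * Q)) := by
    have : quarterPeriod q / (T / 4) = 2 * Q := by rw [hQ]; field_simp; ring
    rw [quarterEigenvalue, this, Real.mul_rpow two_pos.le hQ0.le]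
    have : Q ^ q = Q ^ (q - 1) * Q := by rw [← Real.rpow_add_one hQ0.ne', sub_add_cancel]
    rw [this]
    ring
  have hQr := Real.rpow_pos_of_pos hQ0 (q - 1)
  rw [h5]
  calc _ ≤ (1 + q) * (Q ^ (q - 1) * (2 / T)) := h1.trans h2
    _ < 2 ^ q * (Q ^ (q - 1) * (2 / T)) := mul_lt_mul_of_pos_right h3 (by positivity)
    _ ≤ _ := by gcongr

end FirstEigenvalue

/-! ### Lower bound for the second variational eigenvalue. -/

section SecondEigenvalue

variable {r T : ℝ}

theorem quarterEigenvalue_mul_normPow_le_of_midpoint (hr : 1 < r) (hT : 0 < T) {u du : ℝ → ℝ}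
    (h : MemSobolevZero T r u du) (hmid : ∫ t in (0 : ℝ)..T / 2, du t = 0) :
    quarterEigenvalue r (T / 4) * normPow T r u ≤ normPow T r du := by
  have hg := memLp_integrableOn hr h.2.1
  have hgr := memLp_integrableOn_rpow hr h.2.1
  have h0 := h.integral_eq_zero hr hT
  have hl := half_pos hT
  have hlT : T / 2 ≤ T := by linarith
  have hsub : ∀ x ∈ Icc (T / 2) T, ∫ t in (0 : ℝ)..x, du t = ∫ t in (T / 2)..x, du t := by
    intro x hx
    rw [← intervalIntegral.integral_add_adjacent_intervals
      (intervalIntegrable_of_integrableOn_Ioo hg le_rfl hl.le hlT)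
      (intervalIntegrable_of_integrableOn_Ioo hg hl.le hx.1 hx.2), hmid, zero_add]
  have hUI := integrableOn_abs_primitive_rpow hr hg
  have h1 := dirichlet_inequality hr hl (hg.mono_set (Ioo_subset_Ioo_right hlT))
    (hgr.mono_set (Ioo_subset_Ioo_right hlT)) hmid
  have h2 := dirichlet_inequality hr (half_lt_self hT) (hg.mono_set (Ioo_subset_Ioo_left hl.le))
    (hgr.mono_set (Ioo_subset_Ioo_left hl.le)) (by rw [← hsub T (right_mem_Icc.2 hlT), h0])
  have e1 : (T / 2 - 0) / 2 = T / 4 := by ring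
  have e2 : (T - T / 2) / 2 = T / 4 := by ring
  rw [e1] at h1
  rw [e2] at h2
  rw [h.normPow_eq_primitive hr hT, normPow_eq hT,
    ← intervalIntegral.integral_add_adjacent_intervals
      (intervalIntegrable_of_integrableOn_Ioo hUI le_rfl hl.le hlT)
      (intervalIntegrable_of_integrableOn_Ioo hUI hl.le hlT le_rfl),
    ← intervalIntegral.integral_add_adjacent_intervals
      (intervalIntegrable_of_integrableOn_Ioo hgr le_rfl hl.le hlT)
      (intervalIntegrable_of_integrableOn_Ioo hgr hl.le hlT le_rfl), mul_add,
    setIntegral_congr_interval hlT fun x hx => by rw [hsub x (Ioo_subset_Icc_self hx)]]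
  exact add_le_add h1 h2

local notation "circle" => Metric.sphere (0 : EuclideanSpace ℝ (Fin 2)) 1

lemma preconnectedSpace_circle : PreconnectedSpace circle := by
  refine Subtype.preconnectedSpace (isPreconnected_sphere ?_ 0 1)
  rw [← Module.finrank_eq_rank]
  simp

/-- One-dimensional Borsuk–Ulam: the values at antipodes have opposite signs and the circle is
connected. -/
lemma exists_eq_zero_of_odd {f : circle → ℝ} (hf : Continuous f) (hodd : ∀ z, f (-z) = -f z) :
    ∃ z, f z = 0 := by
  have := preconnectedSpace_circle
  obtain ⟨v, hv⟩ : (circle).Nonempty := NormedSpace.sphere_nonempty.2 zero_le_one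
  let z : circle := ⟨v, hv⟩
  rcases le_total (f z) 0 with h | h
  · exact mem_range.1 (mem_range_of_exists_le_of_exists_ge hf ⟨z, h⟩
      ⟨-z, by rw [hodd]; linarith⟩)
  · exact mem_range.1 (mem_range_of_exists_le_of_exists_ge hf ⟨-z, by rw [hodd]; linarith⟩ ⟨z, h⟩)

theorem IsOddSphereMap.exists_midpoint_eq_zero (hr : 1 < r) (hT : 0 < T)
    {h dh : circle → ℝ → ℝ} (hh : IsOddSphereMap T r 2 h dh) :
    ∃ z, ∫ t in (0 : ℝ)..T / 2, dh z t = 0 := by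
  obtain ⟨hmem, hodd, hcont⟩ := hh
  have hl := half_pos hT
  have hg := fun z => memLp_integrableOn hr (hmem z).1.2.1
  have hmid : T / 2 ∈ Ioo 0 T := ⟨hl, half_lt_self hT⟩
  refine exists_eq_zero_of_odd (continuous_iff_continuousAt.2 fun z₀ => ?_) fun z => ?_
  · have hm : ∀ z, MemLp (dh z - dh z₀) (ENNReal.ofReal r) (intervalMeasure T) :=
      fun z => (hmem z).1.2.1.sub (hmem z₀).1.2.1
    have h1 := tendsto_integral_abs hr hm (hcont z₀)
    refine tendsto_iff_norm_sub_tendsto_zero.2 (squeeze_zero (fun _ => norm_nonneg _)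
      (fun z => ?_) h1)
    refine le_trans (le_of_eq ?_)
      (abs_primitive_le (memLp_integrableOn hr (hm z)) (Ioo_subset_Icc_self hmid))
    simp only [Pi.sub_apply]
    rw [intervalIntegral.integral_sub
      (intervalIntegrable_of_integrableOn_Ioo (hg z) le_rfl hl.le hmid.2.le)
      (intervalIntegrable_of_integrableOn_Ioo (hg z₀) le_rfl hl.le hmid.2.le), Real.norm_eq_abs]
  -- Oddness is known only almost everywhere; continuity of the primitives upgrades it to the single
  -- point T / 2.
  · have hae : (fun x => ∫ t in (0 : ℝ)..x, dh (-z) t)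
        =ᵐ[volume.restrict (Ioo 0 T)] fun x => -∫ t in (0 : ℝ)..x, dh z t := by
      have h1 := (hmem (-z)).1.ae_eq_primitive hr
      have h2 := (hmem z).1.ae_eq_primitive hr
      have h3 := hodd z
      rw [intervalMeasure] at h1 h2 h3
      filter_upwards [h1, h2, h3] with x hx1 hx2 hx3
      rw [← hx1, ← hx2, hx3, Pi.neg_apply]
    exact Measure.eqOn_open_of_ae_eq hae isOpen_Ioo
      ((continuousOn_primitive_of_integrableOn (hg _)).mono Ioo_subset_Icc_self)
      ((continuousOn_primitive_of_integrableOn (hg _)).mono Ioo_subset_Icc_self).neg hmid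

lemma abs_add_rpow_of_mul_eq_zero (hr : 1 < r) {x y : ℝ} (h : x * y = 0) :
    |x + y| ^ r = |x| ^ r + |y| ^ r := by
  have hr0 : r ≠ 0 := by linarith
  rcases mul_eq_zero.1 h with h | h <;> simp [h, Real.zero_rpow hr0]

lemma normPow_linear_combination (hr : 1 < r) {f g : ℝ → ℝ}
    (hf : MemLp f (ENNReal.ofReal r) (intervalMeasure T))
    (hg : MemLp g (ENNReal.ofReal r) (intervalMeasure T)) (hfg : ∀ x, f x * g x = 0) (a b : ℝ) :
    normPow T r (a • f + b • g) = |a| ^ r * normPow T r f + |b| ^ r * normPow T r g := by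
  have hfi : Integrable (fun x => |f x| ^ r) (intervalMeasure T) := memLp_integrableOn_rpow hr hf
  have hgi : Integrable (fun x => |g x| ^ r) (intervalMeasure T) := memLp_integrableOn_rpow hr hg
  rw [normPow, normPow, normPow, ← integral_const_mul, ← integral_const_mul,
    ← integral_add (hfi.const_mul _) (hgi.const_mul _)]
  refine integral_congr_ae (ae_of_all _ fun x => ?_)
  simp only [Pi.add_apply, Pi.smul_apply, smul_eq_mul]
  rw [abs_add_rpow_of_mul_eq_zero hr, abs_mul, abs_mul, Real.mul_rpow (abs_nonneg _) (abs_nonneg _),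
    Real.mul_rpow (abs_nonneg _) (abs_nonneg _)]
  rw [mul_mul_mul_comm, hfg, mul_zero]

lemma IsTestFunction.linear_combination {f g : ℝ → ℝ} (hf : IsTestFunction T f)
    (hg : IsTestFunction T g) (a b : ℝ) :
    IsTestFunction T (a • f + b • g) ∧ deriv (a • f + b • g) = a • deriv f + b • deriv g := by
  refine ⟨⟨(show ContDiff ℝ ∞ (a • f) from hf.1.const_smul a).add
    (show ContDiff ℝ ∞ (b • g) from hg.1.const_smul b),
    hf.2.1.smul_left.add hg.2.1.smul_left, ?_⟩, ?_⟩
  · refine (tsupport_add _ _).trans (union_subset ?_ ?_)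
    · exact (closure_mono (Function.support_const_smul_subset _ _)).trans hf.2.2
    · exact (closure_mono (Function.support_const_smul_subset _ _)).trans hg.2.2
  · ext x
    have h1 := (hf.1.differentiable (by simp)).differentiableAt (x := x)
    have h2 := (hg.1.differentiable (by simp)).differentiableAt (x := x)
    rw [deriv_add (h1.const_smul a) (h2.const_smul b), deriv_const_smul _ h1,
      deriv_const_smul _ h2]
    rfl

/-- Needed because the real `sInf` of the empty set is 0, so a lower bound for the infimum requires
an admissible map. Two bumps with disjoint supports are combined with the coordinates of z and
normalized; disjointness makes r-th powers of norms additive. -/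
theorem exists_isOddSphereMap (hr : 1 < r) (hT : 0 < T) :
    ∃ M, ∃ h dh : circle → ℝ → ℝ, IsOddSphereMap T r 2 h dh ∧
      IsGreatest (range fun z => normPow T r (dh z)) M := by
  have hl := half_pos hT
  obtain ⟨f, hf, hfs, -, hf1⟩ := exists_isTestFunction_subset (T := T) hl le_rfl (by linarith)
  obtain ⟨g, hg, hgs, -, hg1⟩ :=
    exists_isTestFunction_subset (half_lt_self hT) hl.le (le_refl T)
  have hdisj : Disjoint (tsupport f) (tsupport g) :=
    Set.disjoint_left.2 fun x h1 h2 => lt_asymm (hfs h1).2 (hgs h2).1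
  have hfg : ∀ x, f x * g x = 0 := fun x => by
    by_cases hx : x ∈ tsupport f
    · rw [image_eq_zero_of_notMem_tsupport (Set.disjoint_left.1 hdisj hx), mul_zero]
    · rw [image_eq_zero_of_notMem_tsupport hx, zero_mul]
  have hdfg : ∀ x, deriv f x * deriv g x = 0 := fun x => by
    by_cases hx : x ∈ tsupport f
    · have h1 : deriv g x = 0 := by
        by_contra h
        exact Set.disjoint_left.1 hdisj hx (support_deriv_subset h)
      rw [h1, mul_zero]
    · have h1 : deriv f x = 0 := by
        by_contra h
        exact hx (support_deriv_subset h)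
      rw [h1, zero_mul]
  have hpos : ∀ {φ : ℝ → ℝ} {y : ℝ}, IsTestFunction T φ → φ y = 1 → 0 < normPow T r φ := by
    intro φ y hφ hy
    refine normPow_pos hr (hφ.memLp _).1 fun hae => ?_
    have h1 := Measure.eqOn_open_of_ae_eq (by rwa [intervalMeasure] at hae) isOpen_Ioo
      hφ.1.continuous.continuousOn continuousOn_const
    have h2 : y ∈ Ioo 0 T := by
      by_contra h
      rw [hφ.eq_zero h] at hy
      exact zero_ne_one hy
    have h3 := h1 h2
    rw [hy] at h3
    exact one_ne_zero h3
  set A := normPow T r f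
  set B := normPow T r g
  have hA : 0 < A := hpos hf hf1
  have hB : 0 < B := hpos hg hg1
  have hcoord : ∀ i : Fin 2, Continuous fun z : circle => (z : EuclideanSpace ℝ (Fin 2)) i :=
    fun i => by fun_prop
  -- `S z` is the r-th power of the norm of the combination of f and g with coefficients the
  -- coordinates of z, and `N z` below is the norm itself; both are even in z, so dividing by `N z`
  -- keeps the map odd.
  set S : circle → ℝ := fun z => |(z : EuclideanSpace ℝ (Fin 2)) 0| ^ r * A
    + |(z : EuclideanSpace ℝ (Fin 2)) 1| ^ r * B with hS
  have hScont : Continuous S :=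
    (((hcoord 0).abs.rpow_const fun _ => Or.inr (by linarith)).mul continuous_const).add
      (((hcoord 1).abs.rpow_const fun _ => Or.inr (by linarith)).mul continuous_const)
  have hSpos : ∀ z, 0 < S z := by
    intro z
    have h0 : 0 ≤ |(z : EuclideanSpace ℝ (Fin 2)) 0| ^ r * A := by positivity
    have h1 : 0 ≤ |(z : EuclideanSpace ℝ (Fin 2)) 1| ^ r * B := by positivity
    refine (add_nonneg h0 h1).lt_of_ne' fun h => ?_
    have e0 : (z : EuclideanSpace ℝ (Fin 2)) 0 = 0 := by
      by_contra hne
      have : 0 < |(z : EuclideanSpace ℝ (Fin 2)) 0| ^ r * A :=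
        mul_pos (Real.rpow_pos_of_pos (abs_pos.2 hne) _) hA
      linarith
    have e1 : (z : EuclideanSpace ℝ (Fin 2)) 1 = 0 := by
      by_contra hne
      have : 0 < |(z : EuclideanSpace ℝ (Fin 2)) 1| ^ r * B :=
        mul_pos (Real.rpow_pos_of_pos (abs_pos.2 hne) _) hB
      linarith
    have hz : (z : EuclideanSpace ℝ (Fin 2)) = 0 := by
      ext i
      fin_cases i
      · exact e0
      · exact e1
    have := z.2
    rw [mem_sphere_zero_iff_norm, hz, norm_zero] at this
    exact zero_ne_one this
  set N : circle → ℝ := fun z => S z ^ (1 / r) with hN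
  have hNpos : ∀ z, 0 < N z := fun z => Real.rpow_pos_of_pos (hSpos z) _
  have hNcont : Continuous N := hScont.rpow_const fun z => Or.inl (hSpos z).ne'
  have hNr : ∀ z, N z ^ r = S z := fun z => by
    rw [hN]
    simp only
    rw [← Real.rpow_mul (hSpos z).le, one_div_mul_cancel (by linarith), Real.rpow_one]
  have hNneg : ∀ z, N (-z) = N z := fun z => by simp [hN, hS]
  set c : Fin 2 → circle → ℝ := fun i z => (z : EuclideanSpace ℝ (Fin 2)) i / N z with hc
  have hccont : ∀ i, Continuous (c i) := fun i =>
    (hcoord i).div hNcont fun z => (hNpos z).ne'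
  have hcneg : ∀ i z, c i (-z) = -c i z := fun i z => by
    simp only [hc, hNneg]
    simp [neg_div]
  have hcabs : ∀ i z, |c i z| ^ r = |(z : EuclideanSpace ℝ (Fin 2)) i| ^ r / S z := fun i z => by
    simp only [hc]
    rw [abs_div, abs_of_pos (hNpos z), Real.div_rpow (abs_nonneg _) (hNpos z).le, hNr]
  have hnp : ∀ z, normPow T r (c 0 z • deriv f + c 1 z • deriv g)
      = |c 0 z| ^ r * normPow T r (deriv f) + |c 1 z| ^ r * normPow T r (deriv g) := fun z =>
    normPow_linear_combination hr (hf.memLp _).2 (hg.memLp _).2 hdfg _ _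
  have hcontnp : Continuous fun z => normPow T r (c 0 z • deriv f + c 1 z • deriv g) := by
    simp only [hnp]
    exact (((hccont 0).abs.rpow_const fun _ => Or.inr (by linarith)).mul continuous_const).add
      (((hccont 1).abs.rpow_const fun _ => Or.inr (by linarith)).mul continuous_const)
  have hne : Nonempty circle := (NormedSpace.sphere_nonempty.2 zero_le_one).to_subtype
  have hcomp : CompactSpace circle := isCompact_iff_compactSpace.1 (isCompact_sphere _ _)
  obtain ⟨M, hM⟩ := (isCompact_range hcontnp).exists_isGreatest (range_nonempty _)
  refine ⟨M, fun z => c 0 z • f + c 1 z • g, fun z => c 0 z • deriv f + c 1 z • deriv g,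
    ⟨fun z => ⟨?_, ?_⟩, fun z => ae_of_all _ fun x => ?_, fun z₀ => ?_⟩, hM⟩
  · have h1 := hf.linear_combination hg (c 0 z) (c 1 z)
    simp only
    rw [← h1.2]
    exact h1.1.memSobolevZero
  · rw [normPow_linear_combination hr (hf.memLp _).1 (hg.memLp _).1 hfg, hcabs, hcabs,
      div_mul_eq_mul_div, div_mul_eq_mul_div, ← add_div]
    exact div_self (hSpos z).ne'
  · simp only [hcneg, Pi.add_apply, Pi.smul_apply, Pi.neg_apply, smul_eq_mul]
    ring
  · have hlim : ∀ (i : Fin 2) (φ : ℝ → ℝ), MemLp φ (ENNReal.ofReal r) (intervalMeasure T) →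
        Tendsto (fun z => ‖c i z - c i z₀‖ₑ * eLpNorm φ (ENNReal.ofReal r) (intervalMeasure T))
          (𝓝 z₀) (𝓝 0) := by
      intro i φ hφ
      have h1 : Tendsto (fun z => c i z - c i z₀) (𝓝 z₀) (𝓝 0) := by
        have := ((hccont i).tendsto z₀).sub_const (c i z₀)
        rwa [sub_self] at this
      have := ENNReal.Tendsto.mul_const
        (b := eLpNorm φ (ENNReal.ofReal r) (intervalMeasure T)) h1.enorm
        (Or.inr hφ.eLpNorm_ne_top)
      simpa using this
    have h2 := (hlim 0 _ (hf.memLp _).2).add (hlim 1 _ (hg.memLp _).2)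
    rw [add_zero] at h2
    refine tendsto_of_tendsto_of_tendsto_of_le_of_le tendsto_const_nhds h2 (fun _ => zero_le)
      fun z => ?_
    have h3 : c 0 z • deriv f + c 1 z • deriv g - (c 0 z₀ • deriv f + c 1 z₀ • deriv g)
        = (c 0 z - c 0 z₀) • deriv f + (c 1 z - c 1 z₀) • deriv g := by
      ext x
      simp only [Pi.add_apply, Pi.sub_apply, Pi.smul_apply, smul_eq_mul]
      ring
    simp only
    rw [h3, ← eLpNorm_const_smul, ← eLpNorm_const_smul]
    exact eLpNorm_add_le ((hf.memLp (ENNReal.ofReal r)).2.aestronglyMeasurable.const_smul _)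
      ((hg.memLp (ENNReal.ofReal r)).2.aestronglyMeasurable.const_smul _) (one_le_ofReal hr)

theorem quarterEigenvalue_le_variationalEigenvalue (hr : 1 < r) (hT : 0 < T) :
    quarterEigenvalue r (T / 4) ≤ variationalEigenvalue T r 2 := by
  refine le_csInf (exists_isOddSphereMap hr hT) ?_
  rintro M ⟨h, dh, hh, hM⟩
  obtain ⟨z, hz⟩ := hh.exists_midpoint_eq_zero hr hT
  have h1 := quarterEigenvalue_mul_normPow_le_of_midpoint hr hT (hh.1 z).1 hz
  rw [(hh.1 z).2, mul_one] at h1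
  exact h1.trans (hM.2 ⟨z, rfl⟩)

end SecondEigenvalue

end PLaplace1D

/-! ### Conclusion. -/

theorem mainTheorem9 (T p q : ℝ) (hT : 0 < T) (hq : 1 < q) (hqp : q < p) :
    (∃ φ dφ : ℝ → ℝ,
      PLaplace1D.IsEigenfunction T p (PLaplace1D.firstEigenvalue T p) φ dφ) ∧
    ∀ φ dφ : ℝ → ℝ,
      PLaplace1D.IsEigenfunction T p (PLaplace1D.firstEigenvalue T p) φ dφ →
        PLaplace1D.firstEigenvalue T q
            < PLaplace1D.normPow T q dφ / PLaplace1D.normPow T q φ ∧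
          PLaplace1D.normPow T q dφ / PLaplace1D.normPow T q φ
            < PLaplace1D.variationalEigenvalue T q 2 := by
  have hp := hq.trans hqp
  refine ⟨⟨_, _, PLaplace1D.isEigenfunction_wave hp hT⟩, fun φ dφ h => ?_⟩
  rw [h.normPow_div_eq hp hT]
  constructor
  · rw [PLaplace1D.firstEigenvalue_eq hq hT, lt_div_iff₀
      ((div_pos hT (by linarith)).trans_le (PLaplace1D.le_normPow_waveSin hq hp hT))]
    exact PLaplace1D.quarterEigenvalue_mul_normPow_waveSin_lt hq hqp hT
  · exact (PLaplace1D.normPow_wave_div_lt hq hqp hT).trans_le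
      (PLaplace1D.quarterEigenvalue_le_variationalEigenvalue hq hT)
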